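/- **Labelled spaces.** Let $\mathcal E=(\mathcal E^0,\mathcal E^1,r,s)$ be a directed graph with $\mathcal E^0,\mathcal E^1\neq\emptyset$, let $\mathcal L:\mathcal E^1\to\mathcal A$ be a surjective labelling, and let $\mathcal L^*$ be the set of labels of finite paths, including the empty word $\omega$. Let $\mathcal L^{\le\infty}$ consist of $\mathcal L^*$ and of the infinite words over $\mathcal A$ all of whose finite beginnings lie in $\mathcal L^*$. Write $\alpha_{1,n}$ for the beginning of length $n$ of $\alpha$. For $A\subseteq\mathcal E^0$ and $\alpha\in\mathcal L^*$ let $r(A,\alpha)$ be the set of ranges of paths labelled $\alpha$ with source in $A$, with $r(A,\omega)=A$, and let $r(\alpha)=r(\mathcal E^0,\alpha)$. Let $\mathcal B$ be a family of subsets of $\mathcal E^0$ that is closed under finite unions, finite intersections and relative ranges $A\mapsto r(A,\alpha)$, and that contains $r(\alpha)$ for all $\alpha\in\mathcal L^*\setminus\{\omega\}$. Suppose that the labelled space $(\mathcal E,\mathcal L,\mathcal B)$ is *normal* ($A\setminus B\in\mathcal B$ for $A,B\in\mathcal B$) and *weakly left-resolving* ($r(A\cap B,\alpha)=r(A,\alpha)\cap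 r(B,\alpha)$ for $A,B\in\mathcal B$ and $\alpha\in\mathcal L^*\setminus\{\omega\}$). Put $\mathcal B_\alpha=\{A\in\mathcal B: A\subseteq r(\alpha)\}$. **The inverse semigroup.** Let $S=\{(\alpha,A,\beta):\alpha,\beta\in\mathcal L^*,\ \emptyset\ne A\in\mathcal B_\alpha\cap\mathcal B_\beta\}\cup\{0\}$, with $(\alpha,A,\beta)^*=(\beta,A,\alpha)$, with zero element $0$, and with $(\alpha,A,\beta)(\gamma,B,\delta)$ equal to $(\alpha\gamma',r(A,\gamma')\cap B,\delta)$ if $\gamma=\beta\gamma'$, to $(\alpha,A\cap r(B,\beta'),\delta\beta')$ if $\beta=\gamma\beta'$ (provided in each case that the set in the middle is non-empty), and to $0$ otherwise. Its semilattice of idempotents is $E(S)=\{(\alpha,A,\alpha)\in S\}\cup\{0\}$. A character of $E(S)$ is a non-zero map $E(S)\to\{0,1\}$ that preserves zero and meets; characters correspond to filters by $\xi=\{e:\phi(e)=1\}$. The tight spectrum $\hat E_{tight}$ is the closure, in the space of characters with pointwise convergence, of the set of characters of ultrafilters. The set of tight filters (the filters of tight characters) is denoted by $\mathsf T$. **Words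 of filters.** For $\alpha\in\mathcal L^{\le\infty}$, a complete family for $\alpha$ is a family $\{\mathcal F_n\}_{0\le n\le|\alpha|}$ ($n<\infty$) such that $\mathcal F_n$ is a filter in $\mathcal B_{\alpha_{1,n}}$ for $n>0$, $\mathcal F_0$ is a filter in $\mathcal B$ or empty, and $\mathcal F_n=\{A\in\mathcal B_{\alpha_{1,n}}: r(A,\alpha_{n+1})\in\mathcal F_{n+1}\}$ for $0\le n<|\alpha|$. A filter $\xi$ in $E(S)$ has associated word $\alpha$, written $\xi=\xi^\alpha$, if $\xi=\{(\alpha_{1,n},A,\alpha_{1,n}): 0\le n\le|\alpha|,\ A\in\mathcal F_n\}$ for a complete family $\{\mathcal F_n\}$ for $\alpha$; then $\xi_n$ denotes $\mathcal F_n$. Let $\mathsf T_\alpha$ be the set of tight filters with word $\alpha$. For $\alpha\ne\omega$ let $\mathsf T_{(\alpha)\beta}=\{\xi\in\mathsf T_\beta: r(\alpha)\in\xi_0\}$, and let $\mathsf T_{(\omega)\beta}=\mathsf T_\beta$. **Cutting and gluing.** For $\alpha\neq\omega$, $H_{[\alpha]\beta}:\mathsf T_{\alpha\beta}\to\mathsf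 T_{(\alpha)\beta}$ sends $\xi$ to the filter $\eta$ with word $\beta$ and $$\eta_n=\{C\in\mathcal B_{\beta_{1,n}}: D\subseteq C\text{ for some }D\in\xi_{|\alpha|+n}\}\qquad(0\le n\le|\beta|),$$ and $G_{(\alpha)\beta}:\mathsf T_{(\alpha)\beta}\to\mathsf T_{\alpha\beta}$ sends $\xi$ to the filter $\eta$ with word $\alpha\beta$ and with the following family. - If $\beta\ne\omega$: $\eta_{|\alpha|+n}=\{C\cap r(\alpha\beta_{1,n}): C\in\xi_n\}$ for $1\le n\le|\beta|$, and $\eta_i=\{D\in\mathcal B_{\alpha_{1,i}}: r(D,\alpha_{i+1}\cdots\alpha_{|\alpha|}\beta_1)\in\eta_{|\alpha|+1}\}$ for $0\le i\le|\alpha|$. - If $\beta=\omega$: $\eta_{|\alpha|}=\{C\cap r(\alpha): C\in\xi_0\}$, and $\eta_i=\{D\in\mathcal B_{\alpha_{1,i}}: r(D,\alpha_{i+1}\cdots\alpha_{|\alpha|})\in\eta_{|\alpha|}\}$ for $0\le i<|\alpha|$. For $\alpha=\omega$ both maps are the identity. **The two groupoids.** For $s\in S$ and $\phi\in\hat E_{tight}$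 with $\phi(s^*s)=1$ let $\theta_s(\phi)(e)=\phi(s^*es)$. On $\Omega=\{(s,\phi)\in S\times\hat E_{tight}:\phi(s^*s)=1\}$ put $(s,\phi)\sim(t,\psi)$ if $\phi=\psi$ and $se=te$ for some $e\in E(S)$ with $\phi(e)=1$. Let $\mathcal G_{tight}=\Omega/{\sim}$, where $[s,\phi]$ and $[t,\psi]$ are composable if and only if $\phi=\theta_t(\psi)$, with $[s,\phi][t,\psi]=[st,\psi]$ and $[s,\phi]^{-1}=[s^*,\theta_s(\phi)]$. Let $$\Gamma=\{(\xi^{\alpha\gamma},|\alpha|-|\beta|,\eta^{\beta\gamma})\in\mathsf T\times\mathbb Z\times\mathsf T:\ \alpha,\beta\in\mathcal L^*,\ \gamma\in\mathcal L^{\le\infty},\ H_{[\alpha]\gamma}(\xi)=H_{[\beta]\gamma}(\eta)\},$$ where $(\xi,m,\eta)$ and $(\eta',n,\rho)$ are composable if and only if $\eta=\eta'$, with $(\xi,m,\eta)(\eta,n,\rho)=(\xi,m+n,\rho)$ and $(\xi,m,\eta)^{-1}=(\eta,-m,\xi)$. **Theorem.** The relation $\sim$ is an equivalence relation, $\mathcal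 G_{tight}$ and $\Gamma$ are groupoids with well-defined operations as above, and $$\Phi:\mathcal G_{tight}\to\Gamma,\qquad \Phi[t,\phi]=\bigl((G_{(\beta)\alpha'}\circ H_{[\gamma]\alpha'})(\xi^\alpha),\ |\beta|-|\gamma|,\ \xi^\alpha\bigr),$$ is a well-defined isomorphism of groupoids. Here $\xi^\alpha$ is the filter of $\phi$, $t=(\beta,A,\gamma)$, and $\alpha=\gamma\alpha'$ with a unique $\alpha'\in\mathcal L^{\le\infty}$; moreover $H_{[\gamma]\alpha'}(\xi^\alpha)$ lies in $\mathsf T_{(\gamma)\alpha'}\cap\mathsf T_{(\beta)\alpha'}$, and the first component of $\Phi[t,\phi]$ lies in $\mathsf T_{\beta\alpha'}$. -/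

import Mathlib

noncomputable section

/-! Words -/

/-- A finite or infinite word over the alphabet `𝒜`. -/
inductive LWord (𝒜 : Type*) where
  | fin : List 𝒜 → LWord 𝒜
  | inf : Stream' 𝒜 → LWord 𝒜

namespace LWord

variable {𝒜 : Type*}

/-- The length of a word. -/
def length : LWord 𝒜 → ℕ∞
  | fin α => (α.length : ℕ∞)
  | inf _ => ⊤

/-- The beginning `w_{1,n}` consisting of the first `n` letters (all of `w` if `|w| ≤ n`). -/
def take (n : ℕ) : LWord 𝒜 → List 𝒜
  | fin α => α.take n
  | inf f => f.take n

/-- The concatenation of a finite word with a word. -/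
def append (α : List 𝒜) : LWord 𝒜 → LWord 𝒜
  | fin β => fin (α ++ β)
  | inf f => inf (α ++ₛ f)

/-- The one-letter word `w_{n+1}`, for `n < |w|`. -/
def letter (n : ℕ) (w : LWord 𝒜) : List 𝒜 := (w.take (n + 1)).drop n

end LWord

/-! Labelled graphs and labelled spaces -/

/-- A labelled graph: a directed graph with vertex set `V` and edge set `D`, both non-empty, and a
surjective labelling of its edges by the alphabet `𝒜`. -/
structure LabelledGraph (V D 𝒜 : Type*) where
  src : D → V
  rng : D → V
  lab : D → 𝒜
  nonempty_vertices : Nonempty V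
  nonempty_edges : Nonempty D
  lab_surjective : Function.Surjective lab

namespace LabelledGraph

variable {V D 𝒜 : Type*} (E : LabelledGraph V D 𝒜)

/-- `E.IsPath v p w`: the list of edges `p` is a path with source `v` and range `w`; the empty list
is the path of length zero at a vertex. -/
def IsPath : V → List D → V → Prop
  | v, [], w => v = w
  | v, e :: p, w => E.src e = v ∧ IsPath (E.rng e) p w

/-- The finite labelled paths, including the empty word. -/
def IsLabelled (α : List 𝒜) : Prop := ∃ v p w, E.IsPath v p w ∧ p.map E.lab = α

/-- The labelled paths of finite or infinite length; an infinite word is a labelled path if all its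
finite beginnings are. -/
def IsLabelledWord : LWord 𝒜 → Prop
  | .fin α => E.IsLabelled α
  | .inf f => ∀ n, E.IsLabelled (f.take n)

/-- The relative range `r(A, α)`. -/
def relRange (A : Set V) (α : List 𝒜) : Set V :=
  {w | ∃ v ∈ A, ∃ p, E.IsPath v p w ∧ p.map E.lab = α}

/-- The range `r(α)`. -/
def range (α : List 𝒜) : Set V := E.relRange Set.univ α

variable {E}

theorem IsPath.append {u v w : V} {p q : List D} (hp : E.IsPath u p v) (hq : E.IsPath v q w) :
    E.IsPath u (p ++ q) w := by
  induction p generalizing u with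
  | nil =>
    have h : u = v := hp
    subst h
    exact hq
  | cons e p ih => exact ⟨hp.1, ih hp.2⟩

theorem isLabelled_of_mem_relRange {A : Set V} {α : List 𝒜} {w : V} (h : w ∈ E.relRange A α) :
    E.IsLabelled α := by
  obtain ⟨v, _, p, hp⟩ := h
  exact ⟨v, p, w, hp⟩

theorem relRange_subset_range_append {A : Set V} {α β : List 𝒜} (hA : A ⊆ E.range α) :
    E.relRange A β ⊆ E.range (α ++ β) := by
  rintro w ⟨v, hv, q, hq, rfl⟩
  obtain ⟨u, hu, p, hp, rfl⟩ := hA hv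
  exact ⟨u, hu, p ++ q, hp.append hq, by simp⟩

end LabelledGraph

/-- A labelled space: a labelled graph together with a family of sets of vertices that is closed
under finite intersections, finite unions and relative ranges and contains the range of every
labelled path of positive length. -/
structure LabelledSpace (V D 𝒜 : Type*) extends LabelledGraph V D 𝒜 where
  fam : Set (Set V)
  inter_mem : ∀ A ∈ fam, ∀ B ∈ fam, A ∩ B ∈ fam
  union_mem : ∀ A ∈ fam, ∀ B ∈ fam, A ∪ B ∈ fam
  range_mem : ∀ α : List 𝒜, α ≠ [] → toLabelledGraph.IsLabelled α → toLabelledGraph.range α ∈ fam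
  relRange_mem : ∀ A ∈ fam, ∀ α : List 𝒜, toLabelledGraph.IsLabelled α →
    toLabelledGraph.relRange A α ∈ fam

namespace LabelledSpace

variable {V D 𝒜 : Type*} (L : LabelledSpace V D 𝒜)

/-- The labelled space is normal: closed under relative complements. -/
def Normal : Prop := ∀ A ∈ L.fam, ∀ B ∈ L.fam, A \ B ∈ L.fam

/-- The labelled space is weakly left-resolving. -/
def WeaklyLeftResolving : Prop :=
  ∀ A ∈ L.fam, ∀ B ∈ L.fam, ∀ α : List 𝒜, α ≠ [] → L.IsLabelled α →
    L.relRange (A ∩ B) α = L.relRange A α ∩ L.relRange B α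

/-- The members of the family that are contained in `r(α)`. -/
def famAt (α : List 𝒜) : Set (Set V) := {A | A ∈ L.fam ∧ A ⊆ L.range α}

/-! The inverse semigroup -/

/-- The non-zero elements `(α, A, β)` of the inverse semigroup. -/
structure Triple where
  left : List 𝒜
  set : Set V
  right : List 𝒜
  left_labelled : L.IsLabelled left
  right_labelled : L.IsLabelled right
  mem_left : set ∈ L.famAt left
  mem_right : set ∈ L.famAt right
  nonempty : set.Nonempty

/-- The inverse semigroup `S` of the labelled space. -/
inductive S where
  | zero : S
  | tri : L.Triple → S

variable {L}

/-- The triple `(αγ', r(A,γ') ∩ B, δ)`. -/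
def Triple.mulRight (s t : L.Triple) (γ' : List 𝒜)
    (h : (L.relRange s.set γ' ∩ t.set).Nonempty) : L.Triple where
  left := s.left ++ γ'
  set := L.relRange s.set γ' ∩ t.set
  right := t.right
  left_labelled := by
    obtain ⟨w, hw, _⟩ := h
    exact LabelledGraph.isLabelled_of_mem_relRange
      (LabelledGraph.relRange_subset_range_append s.mem_left.2 hw)
  right_labelled := t.right_labelled
  mem_left := by
    have hγ : L.IsLabelled γ' := LabelledGraph.isLabelled_of_mem_relRange h.choose_spec.1
    exact ⟨L.inter_mem _ (L.relRange_mem _ s.mem_left.1 _ hγ) _ t.mem_left.1,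
      fun w hw => LabelledGraph.relRange_subset_range_append s.mem_left.2 hw.1⟩
  mem_right := by
    have hγ : L.IsLabelled γ' := LabelledGraph.isLabelled_of_mem_relRange h.choose_spec.1
    exact ⟨L.inter_mem _ (L.relRange_mem _ s.mem_left.1 _ hγ) _ t.mem_left.1,
      fun w hw => t.mem_right.2 hw.2⟩
  nonempty := h

/-- The triple `(α, A ∩ r(B,β'), δβ')`. -/
def Triple.mulLeft (s t : L.Triple) (β' : List 𝒜)
    (h : (s.set ∩ L.relRange t.set β').Nonempty) : L.Triple where
  left := s.left
  set := s.set ∩ L.relRange t.set β'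
  right := t.right ++ β'
  left_labelled := s.left_labelled
  right_labelled := by
    obtain ⟨w, _, hw⟩ := h
    exact LabelledGraph.isLabelled_of_mem_relRange
      (LabelledGraph.relRange_subset_range_append t.mem_right.2 hw)
  mem_left := by
    have hβ : L.IsLabelled β' := LabelledGraph.isLabelled_of_mem_relRange h.choose_spec.2
    exact ⟨L.inter_mem _ s.mem_left.1 _ (L.relRange_mem _ t.mem_left.1 _ hβ),
      fun w hw => s.mem_left.2 hw.1⟩
  mem_right := by
    have hβ : L.IsLabelled β' := LabelledGraph.isLabelled_of_mem_relRange h.choose_spec.2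
    exact ⟨L.inter_mem _ s.mem_left.1 _ (L.relRange_mem _ t.mem_left.1 _ hβ),
      fun w hw => LabelledGraph.relRange_subset_range_append t.mem_right.2 hw.2⟩
  nonempty := h

instance : Zero L.S := ⟨S.zero⟩

open Classical in
/-- The product of non-zero elements: for `s = (α, A, β)` and `t = (γ, B, δ)`, it is
`(αγ', r(A,γ') ∩ B, δ)` if `γ = βγ'`, it is `(α, A ∩ r(B,β'), δβ')` if `β = γβ'`, provided that the
set is non-empty, and zero otherwise. -/
def Triple.mul (s t : L.Triple) : L.S :=
  if h : s.right <+: t.left ∧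
      (L.relRange s.set (t.left.drop s.right.length) ∩ t.set).Nonempty then
    .tri (s.mulRight t (t.left.drop s.right.length) h.2)
  else if h : t.left <+: s.right ∧
      (s.set ∩ L.relRange t.set (s.right.drop t.left.length)).Nonempty then
    .tri (s.mulLeft t (s.right.drop t.left.length) h.2)
  else .zero

/-- The involution `(α, A, β)* = (β, A, α)`. -/
def Triple.adj (t : L.Triple) : L.Triple :=
  ⟨t.right, t.set, t.left, t.right_labelled, t.left_labelled, t.mem_right, t.mem_left, t.nonempty⟩

/-- The product of the inverse semigroup. -/
def S.mul : L.S → L.S → L.S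
  | .tri s, .tri t => s.mul t
  | _, _ => .zero

instance : Mul L.S := ⟨S.mul⟩

/-- The involution of the inverse semigroup. -/
def S.adj : L.S → L.S
  | .zero => .zero
  | .tri t => .tri t.adj

instance : Star L.S := ⟨S.adj⟩

/-- The elements of the semilattice `E(S)`: zero and the triples `(α, A, α)`. -/
def S.IsIdem : L.S → Prop
  | .zero => True
  | .tri t => t.left = t.right

theorem Triple.mul_cases (s t : L.Triple) : s.mul t = .zero ∨ ∃ u : L.Triple, s.mul t = .tri u ∧
    ((∃ δ, t.left = s.right ++ δ ∧ u.left = s.left ++ δ ∧ u.right = t.right) ∨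
      (∃ δ, s.right = t.left ++ δ ∧ u.left = s.left ∧ u.right = t.right ++ δ)) := by
  by_cases h1 : s.right <+: t.left ∧
      (L.relRange s.set (t.left.drop s.right.length) ∩ t.set).Nonempty
  · exact Or.inr ⟨_, dif_pos h1, Or.inl ⟨_, (List.prefix_iff_eq_append.1 h1.1).symm, rfl, rfl⟩⟩
  by_cases h2 : t.left <+: s.right ∧
      (s.set ∩ L.relRange t.set (s.right.drop t.left.length)).Nonempty
  · exact Or.inr ⟨_, (dif_neg h1).trans (dif_pos h2),
      Or.inr ⟨_, (List.prefix_iff_eq_append.1 h2.1).symm, rfl, rfl⟩⟩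
  · exact Or.inl ((dif_neg h1).trans (dif_neg h2))

theorem S.IsIdem.mul {e f : L.S} (he : e.IsIdem) (hf : f.IsIdem) : (e * f).IsIdem := by
  rcases e with _ | e
  · trivial
  rcases f with _ | f
  · trivial
  have he' : e.left = e.right := he
  have hf' : f.left = f.right := hf
  change (e.mul f).IsIdem
  rcases e.mul_cases f with h | ⟨u, h, ⟨δ, h1, h2, h3⟩ | ⟨δ, h1, h2, h3⟩⟩ <;> rw [h]
  · trivial
  · change u.left = u.right
    rw [h2, h3, he', ← h1, hf']
  · change u.left = u.right
    rw [h2, h3, he', h1, hf']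

theorem S.isIdem_star_mul_self (s : L.S) : (star s * s).IsIdem := by
  rcases s with _ | s
  · trivial
  change (s.adj.mul s).IsIdem
  have ha : s.adj.left = s.right := rfl
  have hb : s.adj.right = s.left := rfl
  rcases s.adj.mul_cases s with h | ⟨u, h, ⟨δ, h1, h2, h3⟩ | ⟨δ, h1, h2, h3⟩⟩ <;> rw [h]
  · trivial
  · change u.left = u.right
    rw [hb] at h1
    rw [h2, h3, ha, List.self_eq_append_right.1 h1, List.append_nil]
  · change u.left = u.right
    rw [hb] at h1
    rw [h2, h3, ha, List.self_eq_append_right.1 h1, List.append_nil]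

theorem S.IsIdem.conj (s : L.S) {e : L.S} (he : e.IsIdem) : (star s * e * s).IsIdem := by
  rcases s with _ | s
  · trivial
  rcases e with _ | e
  · trivial
  have he' : e.left = e.right := he
  change (S.mul (s.adj.mul e) (.tri s)).IsIdem
  have ha : s.adj.left = s.right := rfl
  have hb : s.adj.right = s.left := rfl
  rcases s.adj.mul_cases e with h | ⟨u, h, hu⟩ <;> rw [h]
  · trivial
  change (u.mul s).IsIdem
  rcases u.mul_cases s with k | ⟨v, k, hv⟩ <;> rw [k]
  · trivial
  change v.left = v.right
  rw [ha, hb] at hu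
  rcases hu with ⟨δ, h1, h2, h3⟩ | ⟨δ, h1, h2, h3⟩ <;>
    rcases hv with ⟨ε, k1, k2, k3⟩ | ⟨ε, k1, k2, k3⟩
  · rw [h3, ← he', h1, List.append_assoc] at k1
    have h0 := List.self_eq_append_right.1 k1
    rw [List.append_eq_nil_iff] at h0
    rw [k2, k3, h2, h0.1, h0.2]
    simp
  · rw [h3, ← he', h1] at k1
    rw [k2, k3, h2, List.append_cancel_left k1]
  · rw [h3, ← he', ← h1] at k1
    rw [k2, k3, h2, List.self_eq_append_right.1 k1, List.append_nil]
  · rw [h3, ← he', ← h1] at k1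
    rw [k2, k3, h2, List.self_eq_append_right.1 k1, List.append_nil]

variable (L)

/-- The semilattice `E(S)`. -/
def Idem : Type _ := {e : L.S // e.IsIdem}

variable {L}

instance : Zero L.Idem := ⟨⟨0, trivial⟩⟩

/-- The meet of `E(S)` is the product of `S`. -/
instance : Mul L.Idem := ⟨fun e f => ⟨e.1 * f.1, e.2.mul f.2⟩⟩

/-- `e.IsTriple δ A`: the element `e` of `E(S)` is `(δ, A, δ)`. -/
def Idem.IsTriple (e : L.Idem) (δ : List 𝒜) (A : Set V) : Prop :=
  ∃ t : L.Triple, e.1 = .tri t ∧ t.left = δ ∧ t.set = A ∧ t.right = δ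

/-! Characters, the tight spectrum and tight filters -/

/-- The characters of `E(S)`: non-zero, zero-preserving, meet-preserving maps to the Boolean algebra
`{0,1}`. -/
structure IsCharacter (φ : L.Idem → Bool) : Prop where
  map_zero : φ 0 = false
  map_mul : ∀ e f, φ (e * f) = (φ e && φ f)
  ne_zero : ∃ e, φ e = true

/-- The filter in `E(S)` that corresponds to a character. -/
def filterOf (φ : L.Idem → Bool) : Set L.Idem := {e | φ e = true}

variable (L)

/-- The tight spectrum: the closure, within the characters and for pointwise convergence, of the set
of those characters whose filters are ultrafilters, that is, of the maximal characters. -/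
def tightSpectrum : Set (L.Idem → Bool) :=
  {φ | IsCharacter φ ∧ φ ∈ closure {ψ : L.Idem → Bool | Maximal IsCharacter ψ}}

/-- The tight filters in `E(S)`. -/
def tightFilters : Set (Set L.Idem) := filterOf '' L.tightSpectrum

/-! The word and the complete family of a filter -/

/-- Filters in a family `B` of sets. -/
structure IsFilterIn (B F : Set (Set V)) : Prop where
  subset : F ⊆ B
  nonempty : F.Nonempty
  empty_notMem : ∅ ∉ F
  inter_mem : ∀ X ∈ F, ∀ Y ∈ F, X ∩ Y ∈ F
  mem_of_subset : ∀ X ∈ F, ∀ Y ∈ B, X ⊆ Y → Y ∈ F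

/-- The family `F_n`, `0 ≤ n ≤ |w|`, is complete for the labelled path `w`. -/
structure IsCompleteFamily (w : LWord 𝒜) (F : ℕ → Set (Set V)) : Prop where
  labelled : L.IsLabelledWord w
  isFilter : ∀ n : ℕ, 0 < n → (n : ℕ∞) ≤ w.length → IsFilterIn (L.famAt (w.take n)) (F n)
  isFilter_zero : IsFilterIn L.fam (F 0) ∨ F 0 = ∅
  complete : ∀ n : ℕ, (n : ℕ∞) < w.length →
    F n = {A | A ∈ L.famAt (w.take n) ∧ L.relRange A (w.letter n) ∈ F (n + 1)}

/-- The subset of `E(S)` associated with a word `w` and a family `F_n`, `0 ≤ n ≤ |w|`: all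
`(w_{1,n}, A, w_{1,n})` with `A ∈ F_n`. -/
def ofFamily (w : LWord 𝒜) (F : ℕ → Set (Set V)) : Set L.Idem :=
  {e | ∃ n : ℕ, (n : ℕ∞) ≤ w.length ∧ ∃ A ∈ F n, e.IsTriple (w.take n) A}

/-- `w` is the labelled path associated with the filter `ξ`. -/
def HasWord (ξ : Set L.Idem) (w : LWord 𝒜) : Prop :=
  ∃ F, L.IsCompleteFamily w F ∧ ξ = L.ofFamily w F

variable {L} in
/-- The sets `A` with `(δ, A, δ) ∈ ξ`. If `w` is the word of `ξ` and `n ≤ |w|`, then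
`fiber ξ w_{1,n}` is the member `ξ_n` of the family of `ξ`. -/
def fiber (ξ : Set L.Idem) (δ : List 𝒜) : Set (Set V) := {A | ∃ e ∈ ξ, e.IsTriple δ A}

/-- The tight filters with associated word `w`. -/
def tightWithWord (w : LWord 𝒜) : Set (Set L.Idem) := {ξ | ξ ∈ L.tightFilters ∧ L.HasWord ξ w}

/-! Cutting and gluing -/

/-- `f_{α[β]}`. -/
def fMap (α β : List 𝒜) (F : Set (Set V)) : Set (Set V) :=
  {A | A ∈ L.famAt α ∧ L.relRange A β ∈ F}

/-- `g_{(α)β}`. -/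
def gMap (α β : List 𝒜) (F : Set (Set V)) : Set (Set V) := {B | ∃ C ∈ F, B = C ∩ L.range (α ++ β)}

/-- `h_{[α]β}`; the formula does not involve `α`. -/
def hMap (β : List 𝒜) (F : Set (Set V)) : Set (Set V) := {C | C ∈ L.famAt β ∧ ∃ A ∈ F, A ⊆ C}

/-- The domain of `G_{(α)β}`: the tight filters `ξ` with word `β` such that, if `α` is not empty,
`r(α) ∈ ξ_0`. -/
def glueDomain (α : List 𝒜) (β : LWord 𝒜) : Set (Set L.Idem) :=
  {ξ | ξ ∈ L.tightWithWord β ∧ (α ≠ [] → L.range α ∈ fiber ξ [])}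

/-- The family of `G_{(α)β}(ξ)`, for `α` not empty. -/
def glueFamily (α : List 𝒜) (β : LWord 𝒜) (ξ : Set L.Idem) (n : ℕ) : Set (Set V) :=
  open Classical in
  if β = .fin [] then
    if n < α.length then L.fMap (α.take n) (α.drop n) (L.gMap α [] (fiber ξ []))
    else L.gMap α [] (fiber ξ [])
  else
    if n ≤ α.length then
      L.fMap (α.take n) (α.drop n ++ β.take 1) (L.gMap α (β.take 1) (fiber ξ (β.take 1)))
    else L.gMap α (β.take (n - α.length)) (fiber ξ (β.take (n - α.length)))

/-- The gluing map `G_{(α)β}`. -/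
def glue (α : List 𝒜) (β : LWord 𝒜) (ξ : Set L.Idem) : Set L.Idem :=
  open Classical in
  if α = [] then ξ else L.ofFamily (β.append α) (L.glueFamily α β ξ)

/-- The cutting map `H_{[α]β}`. -/
def cut (α : List 𝒜) (β : LWord 𝒜) (ξ : Set L.Idem) : Set L.Idem :=
  open Classical in
  if α = [] then ξ else L.ofFamily β (fun n => L.hMap (β.take n) (fiber ξ (α ++ β.take n)))

end LabelledSpace

/-! Groupoids -/

/-- A groupoid in the algebraic sense: a set with a partially defined product and an inverse. -/
structure AlgGroupoid (G : Type*) where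
  Comp : G → G → Prop
  mul : ∀ g h, Comp g h → G
  inv : G → G
  inv_inv : ∀ g, inv (inv g) = g
  assoc : ∀ g h k (hgh : Comp g h) (hhk : Comp h k),
    ∃ (h₁ : Comp (mul g h hgh) k) (h₂ : Comp g (mul h k hhk)),
      mul (mul g h hgh) k h₁ = mul g (mul h k hhk) h₂
  inv_comp : ∀ g, Comp (inv g) g
  comp_inv : ∀ g, Comp g (inv g)
  inv_mul : ∀ g h (hgh : Comp g h),
    ∃ h₁ : Comp (inv g) (mul g h hgh), mul (inv g) (mul g h hgh) h₁ = h
  mul_inv : ∀ g h (hgh : Comp g h),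
    ∃ h₁ : Comp (mul g h hgh) (inv h), mul (mul g h hgh) (inv h) h₁ = g

/-- An isomorphism of groupoids. -/
structure AlgGroupoid.Iso {G H : Type*} (𝒢 : AlgGroupoid G) (ℋ : AlgGroupoid H) extends
    G ≃ H where
  comp_iff : ∀ g h, 𝒢.Comp g h ↔ ℋ.Comp (toFun g) (toFun h)
  map_mul : ∀ g h (hgh : 𝒢.Comp g h),
    toFun (𝒢.mul g h hgh) = ℋ.mul (toFun g) (toFun h) ((comp_iff g h).1 hgh)
  map_inv : ∀ g, toFun (𝒢.inv g) = ℋ.inv (toFun g)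

namespace LabelledSpace

variable {V D 𝒜 : Type*} (L : LabelledSpace V D 𝒜)

/-! The groupoid of germs -/

variable {L} in
/-- The action on characters: `θ_s(φ)(e) = φ(s* e s)`. -/
def act (s : L.S) (φ : L.Idem → Bool) : L.Idem → Bool := fun e => φ ⟨star s * e.1 * s, e.2.conj s⟩

/-- The set `Ω` of pairs `(s, φ)` with `φ` in the tight spectrum and `φ(s* s) = 1`. -/
structure Omega where
  elt : L.S
  char : L.Idem → Bool
  char_mem : char ∈ L.tightSpectrum
  mem_domain : char ⟨star elt * elt, S.isIdem_star_mul_self elt⟩ = true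

/-- The relation `(s, φ) ~ (t, ψ)`: `φ = ψ`, and `se = te` for some `e` in `E(S)` with
`φ(e) = 1`. -/
def germRel (x y : L.Omega) : Prop :=
  x.char = y.char ∧ ∃ e : L.Idem, x.char e = true ∧ x.elt * e.1 = y.elt * e.1

/-- The set of germs, the quotient of `Ω` by `~`. -/
def Germ : Type _ := Quot L.germRel

variable {L} in
/-- The germ `[s, φ]`. -/
def germ (x : L.Omega) : L.Germ := Quot.mk _ x

variable {L} in
/-- `𝒢` is the tight groupoid: `[s, φ]` and `[t, ψ]` are composable if and only if `φ = θ_t(ψ)`,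
then `[s, φ][t, ψ] = [st, ψ]`, and `[s, φ]⁻¹ = [s*, θ_s(φ)]`. -/
structure IsTightGroupoid (𝒢 : AlgGroupoid L.Germ) : Prop where
  comp_iff : ∀ x y : L.Omega, 𝒢.Comp (germ x) (germ y) ↔ x.char = act y.elt y.char
  mul_eq : ∀ (x y : L.Omega) (h : 𝒢.Comp (germ x) (germ y)),
    ∃ z : L.Omega, z.elt = x.elt * y.elt ∧ z.char = y.char ∧
      𝒢.mul (germ x) (germ y) h = germ z
  inv_eq : ∀ x : L.Omega,
    ∃ z : L.Omega, z.elt = star x.elt ∧ z.char = act x.elt x.char ∧ 𝒢.inv (germ x) = germ z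

/-! The boundary path groupoid -/

/-- The set `Γ` of triples `(ξ, |α| - |β|, η)`, where `ξ` and `η` are tight filters with words `αγ`
and `βγ` such that `H_{[α]γ}(ξ) = H_{[β]γ}(η)`. -/
def Boundary : Type _ :=
  {x : L.tightFilters × ℤ × L.tightFilters //
    ∃ (α β : List 𝒜) (γ : LWord 𝒜), L.IsLabelled α ∧ L.IsLabelled β ∧ L.IsLabelledWord γ ∧
      L.HasWord x.1 (γ.append α) ∧ L.HasWord x.2.2 (γ.append β) ∧
      x.2.1 = (α.length : ℤ) - (β.length : ℤ) ∧ L.cut α γ x.1 = L.cut β γ x.2.2}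

variable {L} in
/-- `ℬ` is the groupoid `Γ`: `(ξ, m, η)(η, n, ρ) = (ξ, m + n, ρ)` and
`(ξ, m, η)⁻¹ = (η, -m, ξ)`. -/
structure IsBoundaryGroupoid (ℬ : AlgGroupoid L.Boundary) : Prop where
  comp_iff : ∀ x y : L.Boundary, ℬ.Comp x y ↔ x.1.2.2 = y.1.1
  mul_eq : ∀ (x y : L.Boundary) (h : ℬ.Comp x y),
    (ℬ.mul x y h).1 = (x.1.1, x.1.2.1 + y.1.2.1, y.1.2.2)
  inv_eq : ∀ x : L.Boundary, (ℬ.inv x).1 = (x.1.2.2, -x.1.2.1, x.1.1)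

end LabelledSpace

end

/-! The element (β, A, γ) acts on tight filters by replacing the beginning γ of the word by β.
Indeed (β, A, γ) = (β, r(β), ω)(ω, A, γ) for β ≠ ω; the action of the right factor is the cutting
map and that of the left factor is the gluing map (`IsCharacter.cut_eq_act`,
`IsCharacter.glue_eq_act`). Hence `G ∘ H` is θ_t, and Φ is the map [t, φ] ↦ (θ_t(φ), |β| - |γ|, φ),
which no longer mentions words.

This map is studied on Ω, before passing to germs. It is onto Γ: filters ξ, η that agree after
cutting α and β are related by (α, r(α) ∩ r(β), β) (`exists_act_eq`). Its fibres are exactly the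
classes of `~` (`toBoundary_eq_iff`): if θ_s(φ) = θ_t(φ) and the degrees agree, comparison of words
shows that the outer words of one element arise from those of the other by appending one common
word, and then s and t agree on an idempotent of the filter. So `~` is the kernel of a map, hence an
equivalence relation, and the germs are in bijection with Γ. Since the map respects products and
inverses, Γ is closed under its operations, and the groupoid structure of Γ, transported to the
germs, is that of the tight groupoid.

Two tools support this. The semigroup is represented faithfully by partial bijections of 𝒜* × V
(`S.rel_mul`, `S.rel_injective`); the product becomes composition because the space is weakly
left-resolving, and the semigroup laws follow. A filter is handled through its fibres, the sets A
with (δ, A, δ) in it: the non-empty δ with non-empty fibre are the non-empty beginnings of its word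
(`IsCharacter.hasWord`), and the fibres of θ_t(φ) have an explicit formula
(`IsCharacter.mem_fiber_act_iff`). -/

/-! ### Words and their finite beginnings -/

namespace LWord

variable {𝒜 : Type*}

/-- The finite word `δ` is a beginning of `w`. -/
def HasPrefix (w : LWord 𝒜) (δ : List 𝒜) : Prop :=
  (δ.length : ℕ∞) ≤ w.length ∧ w.take δ.length = δ

@[simp]
theorem take_zero (w : LWord 𝒜) : w.take 0 = [] := by
  cases w <;> simp [take]

theorem length_take {w : LWord 𝒜} {n : ℕ} (h : (n : ℕ∞) ≤ w.length) :
    (w.take n).length = n := by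
  cases w with
  | fin α => simpa [take, length] using h
  | inf f => simp [take]

theorem hasPrefix_take {w : LWord 𝒜} {n : ℕ} (h : (n : ℕ∞) ≤ w.length) :
    w.HasPrefix (w.take n) := by
  simp only [HasPrefix, length_take h, h, and_self]

theorem hasPrefix_nil (w : LWord 𝒜) : w.HasPrefix [] := by simp [HasPrefix]

theorem hasPrefix_fin {α δ : List 𝒜} : (fin α).HasPrefix δ ↔ δ <+: α := by
  rw [HasPrefix, List.prefix_iff_eq_take]
  constructor
  · rintro ⟨_, h⟩
    exact h.symm
  · intro h
    refine ⟨?_, h.symm⟩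
    have := congrArg List.length h
    rw [List.length_take] at this
    simp only [length, Nat.cast_le]
    omega

theorem hasPrefix_inf {f : Stream' 𝒜} {δ : List 𝒜} :
    (inf f).HasPrefix δ ↔ f.take δ.length = δ := by
  simp [HasPrefix, length, take]

theorem hasPrefix_append_iff {w : LWord 𝒜} {β ε : List 𝒜} :
    (w.append β).HasPrefix (β ++ ε) ↔ w.HasPrefix ε := by
  cases w with
  | fin α => rw [append, hasPrefix_fin, hasPrefix_fin, List.prefix_append_right_inj]
  | inf f =>
    rw [append, hasPrefix_inf, hasPrefix_inf, List.length_append, ← Stream'.append_take]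
    simp

theorem hasPrefix_append_self (w : LWord 𝒜) (β : List 𝒜) : (w.append β).HasPrefix β := by
  have := (hasPrefix_append_iff (w := w) (β := β) (ε := [])).2 w.hasPrefix_nil
  rwa [List.append_nil] at this

theorem HasPrefix.comparable {w : LWord 𝒜} {δ ε : List 𝒜} (h : w.HasPrefix δ)
    (h' : w.HasPrefix ε) : δ <+: ε ∨ ε <+: δ := by
  cases w with
  | fin α =>
    rw [hasPrefix_fin] at h h'
    exact List.prefix_or_prefix_of_prefix h h'
  | inf f =>
    rw [hasPrefix_inf] at h h'
    rw [← h, ← h']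
    rcases le_total δ.length ε.length with hl | hl
    · exact Or.inl ((Stream'.take_prefix _ _ _).2 hl)
    · exact Or.inr ((Stream'.take_prefix _ _ _).2 hl)

theorem HasPrefix.of_prefix {w : LWord 𝒜} {δ ε : List 𝒜} (h : w.HasPrefix ε) (h' : δ <+: ε) :
    w.HasPrefix δ := by
  cases w with
  | fin α =>
    rw [hasPrefix_fin] at *
    exact h'.trans h
  | inf f =>
    rw [hasPrefix_inf] at *
    have h2 : f.take δ.length <+: ε := by
      rw [← h]
      exact (Stream'.take_prefix _ _ _).2 h'.length_le
    exact (List.prefix_of_prefix_length_le h2 h' (by simp)).eq_of_length (by simp)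

theorem HasPrefix.exists_append {w : LWord 𝒜} {δ : List 𝒜} (h : w.HasPrefix δ) :
    ∃ w' : LWord 𝒜, w = w'.append δ := by
  cases w with
  | fin α =>
    obtain ⟨ε, rfl⟩ := hasPrefix_fin.1 h
    exact ⟨fin ε, rfl⟩
  | inf f =>
    rw [hasPrefix_inf] at h
    refine ⟨inf (f.drop δ.length), ?_⟩
    rw [append]
    conv_rhs => rw [← h]
    simp

/-- The empty beginning is left out because the fibre of a filter at the empty word may be empty, so
filters detect only the non-empty beginnings. -/
theorem ext_hasPrefix {w w' : LWord 𝒜} (h : ∀ δ, δ ≠ [] → (w.HasPrefix δ ↔ w'.HasPrefix δ)) :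
    w = w' := by
  have h : ∀ δ, w.HasPrefix δ ↔ w'.HasPrefix δ := fun δ => by
    rcases eq_or_ne δ [] with rfl | hδ
    · simp only [hasPrefix_nil]
    · exact h δ hδ
  have key : ∀ (α : List 𝒜) (f : Stream' 𝒜),
      ¬ ∀ δ, (fin α).HasPrefix δ ↔ (inf f).HasPrefix δ := by
    intro α f h
    have := (h (f.take (α.length + 1))).2 (hasPrefix_inf.2 (by simp))
    have := (hasPrefix_fin.1 this).length_le
    simp at this
  cases w with
  | fin α =>
    cases w' with
    | fin β =>
      have h1 := hasPrefix_fin.1 ((h α).1 (hasPrefix_fin.2 List.prefix_rfl))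
      have h2 := hasPrefix_fin.1 ((h β).2 (hasPrefix_fin.2 List.prefix_rfl))
      rw [h1.eq_of_length_le h2.length_le]
    | inf f => exact absurd h (key α f)
  | inf f =>
    cases w' with
    | fin β => exact absurd (fun δ => (h δ).symm) (key β f)
    | inf g =>
      congr 1
      refine Stream'.take_theorem _ _ fun n => ?_
      have := hasPrefix_inf.1 ((h (f.take n)).1 (hasPrefix_inf.2 (by simp)))
      simpa using this.symm

theorem append_right_injective (β : List 𝒜) :
    Function.Injective (fun w : LWord 𝒜 => w.append β) := by
  intro w w' h
  refine ext_hasPrefix fun δ _ => ?_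
  rw [← hasPrefix_append_iff (β := β), ← hasPrefix_append_iff (β := β) (w := w')]
  exact iff_of_eq (congrArg (fun u : LWord 𝒜 => u.HasPrefix (β ++ δ)) h)

theorem append_append (α β : List 𝒜) (w : LWord 𝒜) :
    w.append (α ++ β) = (w.append β).append α := by
  cases w <;> simp [append, Stream'.append_append_stream]

theorem take_append_add {w : LWord 𝒜} {β : List 𝒜} {n : ℕ} :
    (w.append β).take (β.length + n) = β ++ w.take n := by
  cases w with
  | fin α => simp [append, take, List.take_append]
  | inf f => simp [append, take, Stream'.append_take]

theorem take_append_of_le {w : LWord 𝒜} {β : List 𝒜} {n : ℕ} (hn : n ≤ β.length) :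
    (w.append β).take n = β.take n := by
  have h : (w.append β).HasPrefix (β.take n) :=
    (w.hasPrefix_append_self β).of_prefix (List.take_prefix _ _)
  have := h.2
  rwa [List.length_take_of_le hn] at this

theorem length_append (w : LWord 𝒜) (β : List 𝒜) :
    (w.append β).length = β.length + w.length := by
  cases w with
  | fin α => simp [append, length]
  | inf f => simp [append, length]

theorem take_succ (w : LWord 𝒜) (n : ℕ) : w.take (n + 1) = w.take n ++ w.letter n := by
  have : w.take n = (w.take (n + 1)).take n := by
    cases w with
    | fin α => simp [take, List.take_take]
    | inf f => simp [take, Stream'.take_take]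
  rw [letter, this, List.take_append_drop]

/-- A prefix-closed chain of finite words is the set of beginnings of a word. -/
theorem exists_hasPrefix_iff (P : List 𝒜 → Prop) (h0 : P [])
    (hP : ∀ δ ε, δ <+: ε → P ε → P δ) (hc : ∀ δ ε, P δ → P ε → δ <+: ε ∨ ε <+: δ) :
    ∃ w : LWord 𝒜, ∀ δ, P δ ↔ w.HasPrefix δ := by
  by_cases hb : ∃ n, ∀ δ, P δ → δ.length ≤ n
  · classical
    obtain ⟨α, hα, hmax⟩ : ∃ α, P α ∧ ∀ δ, P δ → δ.length ≤ α.length := by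
      obtain ⟨n, hn⟩ := hb
      induction n with
      | zero => exact ⟨[], h0, fun δ hδ => by simpa using hn δ hδ⟩
      | succ n ih =>
        by_cases h : ∃ α, P α ∧ α.length = n + 1
        · obtain ⟨α, hα, hl⟩ := h
          exact ⟨α, hα, fun δ hδ => hl ▸ hn δ hδ⟩
        · push Not at h
          refine ih fun δ hδ => ?_
          have := hn δ hδ
          have := h δ hδ
          omega
    refine ⟨fin α, fun δ => ?_⟩
    rw [hasPrefix_fin]
    refine ⟨fun hδ => ?_, fun hδ => hP _ _ hδ hα⟩
    rcases hc _ _ hδ hα with h | h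
    · exact h
    · rw [h.eq_of_length_le (hmax δ hδ)]
  · push Not at hb
    have hex : ∀ n, ∃ δ, P δ ∧ δ.length = n := fun n => by
      obtain ⟨δ, hδ, hn⟩ := hb n
      exact ⟨δ.take n, hP _ _ (List.take_prefix _ _) hδ, by simp; omega⟩
    choose d hd hl using hex
    -- The chosen members `d n` of length `n` are nested, so the letter at index `n` may be read off
    -- `d (n + 1)`.
    let f : Stream' 𝒜 := fun n => (d (n + 1))[n]'(by rw [hl]; omega)
    have hf : ∀ n, f.take n = d n := fun n => by
      refine List.ext_getElem (by simp [hl]) fun i hi hi' => ?_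
      rw [Stream'.take_get]
      change (d (i + 1))[i]'(by rw [hl]; omega) = _
      have hp : d (i + 1) <+: d n := by
        rcases hc _ _ (hd (i + 1)) (hd n) with h | h
        · exact h
        · rw [h.eq_of_length_le]
          rw [hl, hl]
          rw [hl] at hi'
          omega
      exact hp.getElem _
    refine ⟨inf f, fun δ => ?_⟩
    rw [hasPrefix_inf, hf]
    constructor
    · intro hδ
      rcases hc _ _ hδ (hd δ.length) with h | h
      · exact (h.eq_of_length (hl _).symm).symm
      · exact h.eq_of_length (hl _)
    · intro h
      rw [← h]
      exact hd _

end LWord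

/-! ### Paths and relative ranges -/

namespace LabelledGraph

variable {V D 𝒜 : Type*} {E : LabelledGraph V D 𝒜}

theorem isPath_append {u w : V} {p q : List D} :
    E.IsPath u (p ++ q) w ↔ ∃ v, E.IsPath u p v ∧ E.IsPath v q w := by
  constructor
  · intro h
    induction p generalizing u with
    | nil => exact ⟨u, rfl, h⟩
    | cons e p ih =>
      obtain ⟨v, hv, hq⟩ := ih h.2
      exact ⟨v, ⟨h.1, hv⟩, hq⟩
  · rintro ⟨v, hp, hq⟩
    exact hp.append hq

@[simp]
theorem relRange_nil (A : Set V) : E.relRange A [] = A := by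
  ext w
  constructor
  · rintro ⟨v, hv, p, hp, hl⟩
    rw [List.map_eq_nil_iff] at hl
    subst hl
    exact (show v = w from hp) ▸ hv
  · intro h
    exact ⟨w, h, [], rfl, rfl⟩

@[simp]
theorem relRange_empty (α : List 𝒜) : E.relRange ∅ α = ∅ := by
  ext w
  simp [relRange]

theorem relRange_mono {A B : Set V} (h : A ⊆ B) (α : List 𝒜) :
    E.relRange A α ⊆ E.relRange B α := by
  rintro w ⟨v, hv, p⟩
  exact ⟨v, h hv, p⟩

theorem relRange_append (A : Set V) (α β : List 𝒜) :
    E.relRange A (α ++ β) = E.relRange (E.relRange A α) β := by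
  ext w
  constructor
  · rintro ⟨u, hu, p, hp, hl⟩
    obtain ⟨p, q, rfl, rfl, rfl⟩ := List.map_eq_append_iff.1 hl
    obtain ⟨v, h1, h2⟩ := isPath_append.1 hp
    exact ⟨v, ⟨u, hu, p, h1, rfl⟩, q, h2, rfl⟩
  · rintro ⟨v, ⟨u, hu, p, hp, rfl⟩, q, hq, rfl⟩
    exact ⟨u, hu, p ++ q, hp.append hq, by simp⟩

theorem range_append (α β : List 𝒜) : E.range (α ++ β) = E.relRange (E.range α) β :=
  relRange_append _ _ _

@[simp]
theorem range_nil : E.range [] = Set.univ := relRange_nil _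

theorem range_append_subset (α β : List 𝒜) : E.range (α ++ β) ⊆ E.range β := by
  rw [range_append]
  exact relRange_mono (Set.subset_univ _) _

theorem isLabelled_nil : E.IsLabelled [] :=
  let ⟨v⟩ := E.nonempty_vertices
  ⟨v, [], v, rfl, rfl⟩

end LabelledGraph

/-! ### The family of a labelled space, and the product of its inverse semigroup -/

namespace LabelledSpace

open LabelledGraph

variable {V D 𝒜 : Type*} {L : LabelledSpace V D 𝒜}

/-- Beyond the definition, the empty word acts trivially, and all relative ranges along a word that
labels no path are empty. -/
theorem WeaklyLeftResolving.relRange_inter (h : L.WeaklyLeftResolving) {A B : Set V}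
    (hA : A ∈ L.fam) (hB : B ∈ L.fam) (α : List 𝒜) :
    L.relRange (A ∩ B) α = L.relRange A α ∩ L.relRange B α := by
  rcases eq_or_ne α [] with rfl | hα
  · simp
  by_cases hl : L.IsLabelled α
  · exact h A hA B hB α hα hl
  · have : ∀ C : Set V, L.relRange C α = ∅ := fun C => by
      by_contra hne
      obtain ⟨w, hw⟩ := Set.nonempty_iff_ne_empty.2 hne
      exact hl (isLabelled_of_mem_relRange hw)
    simp [this]

theorem isLabelled_of_famAt {A : Set V} {δ : List 𝒜} (hA : A ∈ L.famAt δ) (hne : A.Nonempty) :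
    L.IsLabelled δ :=
  let ⟨_, hw⟩ := hne
  isLabelled_of_mem_relRange (hA.2 hw)

theorem relRange_mem_fam {A : Set V} {α : List 𝒜} (hA : A ∈ L.fam)
    (hne : (L.relRange A α).Nonempty) : L.relRange A α ∈ L.fam :=
  let ⟨_, hw⟩ := hne
  L.relRange_mem A hA α (isLabelled_of_mem_relRange hw)

theorem relRange_mem_famAt {A : Set V} {δ ε : List 𝒜} (hA : A ∈ L.famAt δ)
    (hne : (L.relRange A ε).Nonempty) : L.relRange A ε ∈ L.famAt (δ ++ ε) :=
  ⟨relRange_mem_fam hA.1 hne, relRange_subset_range_append hA.2⟩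

theorem famAt_append_subset (δ ε : List 𝒜) : L.famAt (δ ++ ε) ⊆ L.famAt ε :=
  fun _ hA => ⟨hA.1, hA.2.trans (range_append_subset δ ε)⟩

theorem mem_famAt_nil {A : Set V} : A ∈ L.famAt [] ↔ A ∈ L.fam := by simp [famAt]

theorem inter_mem_famAt {A B : Set V} {δ : List 𝒜} (hA : A ∈ L.famAt δ) (hB : B ∈ L.fam) :
    A ∩ B ∈ L.famAt δ :=
  ⟨L.inter_mem _ hA.1 _ hB, Set.inter_subset_left.trans hA.2⟩

/-! The inverse semigroup -/

theorem S.zero_mul (s : L.S) : (0 : L.S) * s = 0 := rfl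

theorem S.mul_zero (s : L.S) : s * (0 : L.S) = 0 := by cases s <;> rfl

@[ext]
theorem Triple.ext' {s t : L.Triple} (h1 : s.left = t.left) (h2 : s.set = t.set)
    (h3 : s.right = t.right) : s = t := by
  cases s
  cases t
  simp only at h1 h2 h3
  subst h1 h2 h3
  rfl

theorem Triple.mul_of_left_eq {s t : L.Triple} {ε : List 𝒜} (h : t.left = s.right ++ ε) :
    (S.tri s * S.tri t = 0 ∧ L.relRange s.set ε ∩ t.set = ∅) ∨
      ∃ u : L.Triple, S.tri s * S.tri t = .tri u ∧ u.left = s.left ++ ε ∧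
        u.set = L.relRange s.set ε ∩ t.set ∧ u.right = t.right := by
  have hd : t.left.drop s.right.length = ε := by simp [h]
  have hp : s.right <+: t.left := ⟨ε, h.symm⟩
  by_cases h1 : s.right <+: t.left ∧
      (L.relRange s.set (t.left.drop s.right.length) ∩ t.set).Nonempty
  · refine Or.inr ⟨_, dif_pos h1, ?_, ?_, rfl⟩
    · simp [Triple.mulRight, hd]
    · simp [Triple.mulRight, hd]
  refine Or.inl ?_
  have he : L.relRange s.set ε ∩ t.set = ∅ := by
    by_contra hne
    rw [hd] at h1
    exact h1 ⟨hp, Set.nonempty_iff_ne_empty.2 hne⟩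
  refine ⟨?_, he⟩
  -- Both rules of the product can apply only for equal inner words; they then give the same set,
  -- which is empty here.
  have h2 : ¬ (t.left <+: s.right ∧
      (s.set ∩ L.relRange t.set (s.right.drop t.left.length)).Nonempty) := by
    rintro ⟨hp', hne⟩
    have hε : ε = [] := by
      have := hp'.length_le
      rw [h, List.length_append] at this
      exact List.length_eq_zero_iff.1 (by omega)
    subst hε
    simp [h] at hne
    rw [relRange_nil] at he
    exact hne.ne_empty he
  exact (dif_neg h1).trans (dif_neg h2)

theorem Triple.mul_of_right_eq {s t : L.Triple} {ε : List 𝒜} (h : s.right = t.left ++ ε) :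
    (S.tri s * S.tri t = 0 ∧ s.set ∩ L.relRange t.set ε = ∅) ∨
      ∃ u : L.Triple, S.tri s * S.tri t = .tri u ∧ u.left = s.left ∧
        u.set = s.set ∩ L.relRange t.set ε ∧ u.right = t.right ++ ε := by
  rcases eq_or_ne ε [] with rfl | hε
  · have h' : t.left = s.right ++ [] := by simpa using h.symm
    simpa using Triple.mul_of_left_eq h'
  have hd : s.right.drop t.left.length = ε := by simp [h]
  have hp : t.left <+: s.right := ⟨ε, h.symm⟩
  have h1 : ¬ (s.right <+: t.left ∧
      (L.relRange s.set (t.left.drop s.right.length) ∩ t.set).Nonempty) := by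
    rintro ⟨hp', -⟩
    have := hp'.length_le
    rw [h, List.length_append] at this
    exact hε (List.length_eq_zero_iff.1 (by omega))
  by_cases h2 : t.left <+: s.right ∧
      (s.set ∩ L.relRange t.set (s.right.drop t.left.length)).Nonempty
  · refine Or.inr ⟨_, (dif_neg h1).trans (dif_pos h2), rfl, ?_, ?_⟩
    · simp [Triple.mulLeft, hd]
    · simp [Triple.mulLeft, hd]
  · refine Or.inl ⟨(dif_neg h1).trans (dif_neg h2), ?_⟩
    rw [hd] at h2
    by_contra hne
    exact h2 ⟨hp, Set.nonempty_iff_ne_empty.2 hne⟩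

theorem Triple.mul_of_not_prefix {s t : L.Triple} (h1 : ¬ s.right <+: t.left)
    (h2 : ¬ t.left <+: s.right) : S.tri s * S.tri t = 0 :=
  (dif_neg fun h => h1 h.1).trans (dif_neg fun h => h2 h.1)

/-- The representation of the inverse semigroup by partial bijections of `𝒜* × V`: the element
`(α, A, β)` relates `(αε, v)` to `(βε, v)` for `v ∈ r(A, ε)`. -/
def S.rel : L.S → List 𝒜 × V → List 𝒜 × V → Prop
  | .zero, _, _ => False
  | .tri t, p, q => ∃ ε, p.1 = t.left ++ ε ∧ q.1 = t.right ++ ε ∧ p.2 = q.2 ∧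
      p.2 ∈ L.relRange t.set ε

theorem S.rel_zero (p q : List 𝒜 × V) : ¬ (0 : L.S).rel p q := id

/-- Composition requires membership in both r(r(A,ε), ζ) and r(B, ζ), the product in r(r(A,ε) ∩ B,
ζ). These sets agree because the space is weakly left-resolving. -/
theorem S.rel_mul (hw : L.WeaklyLeftResolving) (s t : L.S) (p q : List 𝒜 × V) :
    (s * t).rel p q ↔ ∃ m, s.rel p m ∧ t.rel m q := by
  rcases s with _ | s
  · exact ⟨False.elim, fun ⟨_, h, _⟩ => h⟩
  rcases t with _ | t
  · exact ⟨False.elim, fun ⟨_, _, h⟩ => h⟩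
  obtain ⟨p, x⟩ := p
  obtain ⟨q, y⟩ := q
  by_cases h1 : s.right <+: t.left
  · obtain ⟨ε, hε⟩ := h1
    have hr : (∃ m, (S.tri s).rel (p, x) m ∧ (S.tri t).rel m (q, y)) ↔
        ∃ ζ, p = s.left ++ ε ++ ζ ∧ q = t.right ++ ζ ∧ x = y ∧
          x ∈ L.relRange (L.relRange s.set ε ∩ t.set) ζ := by
      constructor
      · rintro ⟨⟨m, z⟩, ⟨η, h1, h2, h3, h4⟩, ⟨ζ, k1, k2, k3, k4⟩⟩
        dsimp only at *
        subst h3 k3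
        rw [h2, ← hε, List.append_assoc, List.append_cancel_left_eq] at k1
        subst k1
        refine ⟨ζ, by simpa using h1, k2, rfl, ?_⟩
        rw [relRange_append] at h4
        have hne : (L.relRange s.set ε).Nonempty := by
          obtain ⟨v, hv, _⟩ := h4
          exact ⟨v, hv⟩
        rw [hw.relRange_inter (relRange_mem_fam s.mem_left.1 hne) t.mem_left.1]
        exact ⟨h4, k4⟩
      · rintro ⟨ζ, h1, h2, h3, h4⟩
        subst h3
        refine ⟨(t.left ++ ζ, x), ⟨ε ++ ζ, by simpa using h1, by simp [← hε], rfl, ?_⟩,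
          ⟨ζ, rfl, h2, rfl, relRange_mono Set.inter_subset_right _ h4⟩⟩
        rw [relRange_append]
        exact relRange_mono Set.inter_subset_left _ h4
    rw [hr]
    rcases Triple.mul_of_left_eq hε.symm with ⟨h, he⟩ | ⟨u, h, u1, u2, u3⟩
    · rw [h, he]
      simp [S.rel_zero]
    · rw [h, ← u1, ← u2, ← u3]
      rfl
  by_cases h2 : t.left <+: s.right
  · obtain ⟨ε, hε⟩ := h2
    have hr : (∃ m, (S.tri s).rel (p, x) m ∧ (S.tri t).rel m (q, y)) ↔
        ∃ ζ, p = s.left ++ ζ ∧ q = t.right ++ ε ++ ζ ∧ x = y ∧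
          x ∈ L.relRange (s.set ∩ L.relRange t.set ε) ζ := by
      constructor
      · rintro ⟨⟨m, z⟩, ⟨ζ, h1, h2, h3, h4⟩, ⟨η, k1, k2, k3, k4⟩⟩
        dsimp only at *
        subst h3 k3
        rw [h2, ← hε, List.append_assoc, List.append_cancel_left_eq] at k1
        subst k1
        refine ⟨ζ, h1, by simpa using k2, rfl, ?_⟩
        rw [relRange_append] at k4
        have hne : (L.relRange t.set ε).Nonempty := by
          obtain ⟨v, hv, _⟩ := k4
          exact ⟨v, hv⟩
        rw [hw.relRange_inter s.mem_left.1 (relRange_mem_fam t.mem_left.1 hne)]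
        exact ⟨h4, k4⟩
      · rintro ⟨ζ, h1, h2, h3, h4⟩
        subst h3
        refine ⟨(s.right ++ ζ, x), ⟨ζ, h1, rfl, rfl, relRange_mono Set.inter_subset_left _ h4⟩,
          ⟨ε ++ ζ, by simp [← hε], by simpa using h2, rfl, ?_⟩⟩
        rw [relRange_append]
        exact relRange_mono Set.inter_subset_right _ h4
    rw [hr]
    rcases Triple.mul_of_right_eq hε.symm with ⟨h, he⟩ | ⟨u, h, u1, u2, u3⟩
    · rw [h, he]
      simp [S.rel_zero]
    · rw [h, ← u1, ← u2, ← u3]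
      rfl
  · rw [Triple.mul_of_not_prefix h1 h2]
    refine ⟨False.elim, ?_⟩
    rintro ⟨m, ⟨ζ, _, k1, _⟩, ⟨η, k2, _⟩⟩
    rcases List.prefix_or_prefix_of_prefix ⟨ζ, k1.symm⟩ ⟨η, k2.symm⟩ with h | h
    · exact h1 h
    · exact h2 h

theorem S.rel_star (s : L.S) (p q : List 𝒜 × V) : (star s).rel p q ↔ s.rel q p := by
  rcases s with _ | s
  · exact Iff.rfl
  · constructor
    · rintro ⟨ε, h1, h2, h3, h4⟩
      exact ⟨ε, h2, h1, h3.symm, h3 ▸ h4⟩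
    · rintro ⟨ε, h1, h2, h3, h4⟩
      exact ⟨ε, h2, h1, h3.symm, h3 ▸ h4⟩

theorem S.rel_unique_right {s : L.S} {p q q' : List 𝒜 × V} (h : s.rel p q) (h' : s.rel p q') :
    q = q' := by
  rcases s with _ | s
  · exact h.elim
  obtain ⟨ε, h1, h2, h3, -⟩ := h
  obtain ⟨ε', k1, k2, k3, -⟩ := h'
  rw [h1, List.append_cancel_left_eq] at k1
  subst k1
  exact Prod.ext (h2.trans k2.symm) (h3.symm.trans k3)

theorem S.rel_unique_left {s : L.S} {p p' q : List 𝒜 × V} (h : s.rel p q) (h' : s.rel p' q) :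
    p = p' :=
  S.rel_unique_right ((S.rel_star _ _ _).2 h) ((S.rel_star _ _ _).2 h')

theorem Triple.rel_self (t : L.Triple) {v : V} (hv : v ∈ t.set) :
    (S.tri t).rel (t.left, v) (t.right, v) :=
  ⟨[], by simp, by simp, rfl, by simpa using hv⟩

/-- The pairs with words `t.left` and `t.right` are the shortest related ones, so the relation
determines both words; the set is then read off at these words. -/
theorem S.rel_injective {s t : L.S} (h : ∀ p q, s.rel p q ↔ t.rel p q) : s = t := by
  rcases s with _ | s <;> rcases t with _ | t
  · rfl
  · obtain ⟨v, hv⟩ := t.nonempty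
    exact ((h _ _).2 (t.rel_self hv)).elim
  · obtain ⟨v, hv⟩ := s.nonempty
    exact ((h _ _).1 (s.rel_self hv)).elim
  · congr 1
    obtain ⟨v, hv⟩ := s.nonempty
    obtain ⟨v', hv'⟩ := t.nonempty
    obtain ⟨ε, h1, h2, -, -⟩ := (h _ _).1 (s.rel_self hv)
    obtain ⟨ε', k1, k2, -, -⟩ := (h _ _).2 (t.rel_self hv')
    dsimp only at *
    have hε : ε = [] := by
      have := congrArg List.length h1
      have h' := congrArg List.length k1
      rw [List.length_append] at this h'
      exact List.length_eq_zero_iff.1 (by omega)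
    subst hε
    rw [List.append_nil] at h1 h2
    refine Triple.ext' h1 (Set.ext fun w => ⟨fun hw => ?_, fun hw => ?_⟩) h2
    · obtain ⟨ζ, m1, -, -, m4⟩ := (h _ _).1 (s.rel_self hw)
      rw [h1] at m1
      rw [List.self_eq_append_right.1 m1] at m4
      simpa using m4
    · obtain ⟨ζ, m1, -, -, m4⟩ := (h _ _).2 (t.rel_self hw)
      rw [← h1] at m1
      rw [List.self_eq_append_right.1 m1] at m4
      simpa using m4

theorem S.IsIdem.eq_of_rel {e : L.S} (he : e.IsIdem) {p q : List 𝒜 × V} (h : e.rel p q) :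
    p = q := by
  rcases e with _ | t
  · exact h.elim
  obtain ⟨ε, h1, h2, h3, -⟩ := h
  have he' : t.left = t.right := he
  exact Prod.ext (by rw [h1, h2, he']) h3

section

variable (hw : L.WeaklyLeftResolving)
include hw

theorem S.mul_assoc (s t u : L.S) : s * t * u = s * (t * u) := by
  refine S.rel_injective fun p q => ?_
  simp only [S.rel_mul hw]
  constructor
  · rintro ⟨m, ⟨n, h1, h2⟩, h3⟩
    exact ⟨n, h1, m, h2, h3⟩
  · rintro ⟨n, h1, m, h2, h3⟩
    exact ⟨m, ⟨n, h1, h2⟩, h3⟩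

theorem S.star_mul (s t : L.S) : star (s * t) = star t * star s := by
  refine S.rel_injective fun p q => ?_
  simp only [S.rel_mul hw, S.rel_star]
  exact exists_congr fun m => and_comm

theorem S.IsIdem.mul_self {e : L.S} (he : e.IsIdem) : e * e = e := by
  refine S.rel_injective fun p q => ?_
  simp only [S.rel_mul hw]
  constructor
  · rintro ⟨m, h1, h2⟩
    rwa [he.eq_of_rel h1]
  · intro h
    have := he.eq_of_rel h
    subst this
    exact ⟨p, h, h⟩

/-- Idempotents are partial identities, and their order is inclusion of domains. -/
theorem S.IsIdem.mul_eq_left {e f : L.S} (he : e.IsIdem) (hf : f.IsIdem)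
    (h : ∀ p, e.rel p p → f.rel p p) : e * f = e := by
  refine S.rel_injective fun p q => ?_
  simp only [S.rel_mul hw]
  constructor
  · rintro ⟨m, h1, h2⟩
    rwa [← hf.eq_of_rel h2]
  · intro h1
    have := he.eq_of_rel h1
    subst this
    exact ⟨p, h1, h p h1⟩

end

theorem S.star_star (s : L.S) : star (star s) = s := by
  cases s <;> rfl

end LabelledSpace

namespace LabelledSpace

open LabelledGraph

variable {V D 𝒜 : Type*} {L : LabelledSpace V D 𝒜}

/-! Idempotents -/

theorem exists_isTriple {δ : List 𝒜} {A : Set V} (hA : A ∈ L.famAt δ) (hne : A.Nonempty) :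
    ∃ e : L.Idem, e.IsTriple δ A :=
  have hδ := isLabelled_of_famAt hA hne
  ⟨⟨.tri ⟨δ, A, δ, hδ, hδ, hA, hA, hne⟩, rfl⟩, _, rfl, rfl, rfl, rfl⟩

namespace Idem

variable {e f : L.Idem} {δ ε : List 𝒜} {A B : Set V}

theorem IsTriple.mem_famAt (h : e.IsTriple δ A) : A ∈ L.famAt δ := by
  obtain ⟨t, -, rfl, rfl, -⟩ := h
  exact t.mem_left

theorem IsTriple.nonempty (h : e.IsTriple δ A) : A.Nonempty := by
  obtain ⟨t, -, -, rfl, -⟩ := h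
  exact t.nonempty

theorem IsTriple.unique (h : e.IsTriple δ A) (h' : e.IsTriple ε B) : δ = ε ∧ A = B := by
  obtain ⟨t, ht, rfl, rfl, -⟩ := h
  obtain ⟨t', ht', rfl, rfl, -⟩ := h'
  rw [ht] at ht'
  cases ht'
  exact ⟨rfl, rfl⟩

theorem IsTriple.rel_iff (h : e.IsTriple δ A) {p : List 𝒜 × V} :
    e.1.rel p p ↔ ∃ ε, p.1 = δ ++ ε ∧ p.2 ∈ L.relRange A ε := by
  obtain ⟨t, ht, h1, rfl, h2⟩ := h
  rw [ht]
  constructor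
  · rintro ⟨ε, h3, -, -, h4⟩
    exact ⟨ε, h1 ▸ h3, h4⟩
  · rintro ⟨ε, h3, h4⟩
    exact ⟨ε, h1 ▸ h3, h2 ▸ h3, rfl, h4⟩

theorem isTriple_of_eq {t : L.Triple} (h : e.1 = .tri t) : e.IsTriple t.left t.set :=
  ⟨t, h, rfl, rfl, by
    have := e.2
    rw [h] at this
    exact this.symm⟩

theorem IsTriple.mul_eq (h : e.IsTriple δ A) (h' : f.IsTriple (δ ++ ε) B) :
    e * f = 0 ∨ (e * f).IsTriple (δ ++ ε) (L.relRange A ε ∩ B) := by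
  obtain ⟨s, hs, rfl, rfl, hs'⟩ := h
  obtain ⟨t, ht, ht', rfl, ht''⟩ := h'
  have hm : (e * f).1 = S.tri s * S.tri t := by rw [← hs, ← ht]; rfl
  rcases Triple.mul_of_left_eq (s := s) (t := t) (ε := ε) (by rw [ht', hs']) with
    ⟨h, -⟩ | ⟨u, h, h1, h2, h3⟩
  · exact Or.inl (Subtype.ext (hm.trans h))
  · exact Or.inr ⟨u, hm.trans h, h1, h2, h3.trans ht''⟩

theorem IsTriple.mul_eq_zero (h : e.IsTriple δ A) (h' : f.IsTriple ε B) (h1 : ¬ δ <+: ε)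
    (h2 : ¬ ε <+: δ) : e * f = 0 := by
  obtain ⟨s, hs, rfl, rfl, hs'⟩ := h
  obtain ⟨t, ht, rfl, rfl, ht'⟩ := h'
  have hm : (e * f).1 = S.tri s * S.tri t := by rw [← hs, ← ht]; rfl
  rw [← hs'] at h1 h2
  exact Subtype.ext (hm.trans (Triple.mul_of_not_prefix h1 h2))

end Idem

/-! Filters of characters and their words -/

namespace IsCharacter

variable {φ : L.Idem → Bool} (hφ : IsCharacter φ)
include hφ

theorem map_mul_eq_true {e f : L.Idem} (he : φ e = true) (hf : φ f = true) : φ (e * f) = true := by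
  rw [hφ.map_mul, he, hf]
  rfl

theorem ne_zero_of_eq_true {e : L.Idem} (he : φ e = true) : e ≠ 0 := by
  rintro rfl
  rw [hφ.map_zero] at he
  exact Bool.false_ne_true he

theorem exists_isTriple {e : L.Idem} (he : φ e = true) : ∃ δ A, e.IsTriple δ A := by
  rcases hs : e.1 with _ | t
  · exact absurd (Subtype.ext hs) (hφ.ne_zero_of_eq_true he)
  · exact ⟨_, _, Idem.isTriple_of_eq hs⟩

theorem fiber_comparable {δ ε : List 𝒜} (hA : (fiber (filterOf φ) δ).Nonempty)
    (hB : (fiber (filterOf φ) ε).Nonempty) : δ <+: ε ∨ ε <+: δ := by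
  obtain ⟨A, e, he, hA⟩ := hA
  obtain ⟨B, f, hf, hB⟩ := hB
  by_contra! h
  exact hφ.ne_zero_of_eq_true (hφ.map_mul_eq_true he hf) (hA.mul_eq_zero hB h.1 h.2)

theorem inter_mem_fiber {δ ε : List 𝒜} {A B : Set V} (hA : A ∈ fiber (filterOf φ) δ)
    (hB : B ∈ fiber (filterOf φ) (δ ++ ε)) :
    L.relRange A ε ∩ B ∈ fiber (filterOf φ) (δ ++ ε) := by
  obtain ⟨e, he, hA⟩ := hA
  obtain ⟨f, hf, hB⟩ := hB
  have h := hφ.map_mul_eq_true he hf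
  exact ⟨e * f, h, (hA.mul_eq hB).resolve_left (hφ.ne_zero_of_eq_true h)⟩

end IsCharacter

theorem fiber_subset_famAt {ξ : Set L.Idem} {δ : List 𝒜} : fiber ξ δ ⊆ L.famAt δ := by
  rintro A ⟨e, -, h⟩
  exact h.mem_famAt

theorem nonempty_of_mem_fiber {ξ : Set L.Idem} {δ : List 𝒜} {A : Set V} (h : A ∈ fiber ξ δ) :
    A.Nonempty := by
  obtain ⟨e, -, h⟩ := h
  exact h.nonempty

section

variable (hw : L.WeaklyLeftResolving) {φ : L.Idem → Bool} (hφ : IsCharacter φ)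
include hw hφ

theorem IsCharacter.eq_true_of_rel {e f : L.Idem} (he : φ e = true)
    (h : ∀ p, e.1.rel p p → f.1.rel p p) : φ f = true := by
  have h1 : e * f = e := Subtype.ext (S.IsIdem.mul_eq_left hw e.2 f.2 h)
  have h2 := hφ.map_mul e f
  rw [h1, he] at h2
  simpa using h2.symm

/-- The inclusion says that (δε, A, δε) ≤ (δ, B, δ) in E(S), and filters are upward closed. -/
theorem IsCharacter.mem_fiber_of_subset {δ ε : List 𝒜} {A B : Set V}
    (hA : A ∈ fiber (filterOf φ) (δ ++ ε)) (hB : B ∈ L.famAt δ) (h : A ⊆ L.relRange B ε) :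
    B ∈ fiber (filterOf φ) δ := by
  have hne : B.Nonempty := by
    obtain ⟨v, hv⟩ := nonempty_of_mem_fiber hA
    obtain ⟨u, hu, -⟩ := h hv
    exact ⟨u, hu⟩
  obtain ⟨f, hf⟩ := LabelledSpace.exists_isTriple hB hne
  obtain ⟨e, he, hA⟩ := hA
  refine ⟨f, hφ.eq_true_of_rel hw he fun p => ?_, hf⟩
  rw [hA.rel_iff, hf.rel_iff]
  rintro ⟨ζ, h1, h2⟩
  refine ⟨ε ++ ζ, by rw [h1, List.append_assoc], ?_⟩
  rw [relRange_append]
  exact relRange_mono h _ h2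

theorem IsCharacter.mem_fiber_of_superset {δ : List 𝒜} {A B : Set V}
    (hA : A ∈ fiber (filterOf φ) δ) (hB : B ∈ L.famAt δ) (h : A ⊆ B) :
    B ∈ fiber (filterOf φ) δ :=
  hφ.mem_fiber_of_subset hw (ε := []) (by rwa [List.append_nil]) hB (by rwa [relRange_nil])

theorem IsCharacter.relRange_mem_fiber {δ ε : List 𝒜} {A : Set V}
    (hA : A ∈ fiber (filterOf φ) δ) (h : (fiber (filterOf φ) (δ ++ ε)).Nonempty) :
    L.relRange A ε ∈ fiber (filterOf φ) (δ ++ ε) := by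
  obtain ⟨B, hB⟩ := h
  have h := hφ.inter_mem_fiber hA hB
  exact hφ.mem_fiber_of_superset hw h (relRange_mem_famAt (fiber_subset_famAt hA)
    ((nonempty_of_mem_fiber h).mono Set.inter_subset_left)) Set.inter_subset_left

/-- This is the completeness condition of a family, for a whole word ε in place of one letter. -/
theorem IsCharacter.fMap_fiber {δ ε : List 𝒜} (h : (fiber (filterOf φ) (δ ++ ε)).Nonempty) :
    L.fMap δ ε (fiber (filterOf φ) (δ ++ ε)) = fiber (filterOf φ) δ := by
  ext A
  exact ⟨fun ⟨h1, h2⟩ => hφ.mem_fiber_of_subset hw h2 h1 subset_rfl,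
    fun hA => ⟨fiber_subset_famAt hA, hφ.relRange_mem_fiber hw hA h⟩⟩

/-- The empty word is excluded since r(ω) is the set of all vertices, which need not belong to the
family. -/
theorem IsCharacter.range_mem_fiber {δ ε : List 𝒜} (hδ : δ ≠ [])
    (h : (fiber (filterOf φ) (δ ++ ε)).Nonempty) : L.range δ ∈ fiber (filterOf φ) δ := by
  obtain ⟨A, hA⟩ := h
  have hA' := fiber_subset_famAt hA
  have hsub : A ⊆ L.relRange (L.range δ) ε := hA'.2.trans (range_append _ _).subset
  refine hφ.mem_fiber_of_subset hw hA ⟨L.range_mem δ hδ ?_, subset_rfl⟩ hsub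
  obtain ⟨v, hv⟩ := nonempty_of_mem_fiber hA
  obtain ⟨u, hu, -⟩ := hsub hv
  exact isLabelled_of_mem_relRange hu

theorem IsCharacter.fiber_nonempty_of_prefix {δ ε : List 𝒜} (hδ : δ ≠ []) (h : δ <+: ε)
    (hε : (fiber (filterOf φ) ε).Nonempty) : (fiber (filterOf φ) δ).Nonempty := by
  obtain ⟨ζ, rfl⟩ := h
  exact ⟨_, hφ.range_mem_fiber hw hδ hε⟩

theorem IsCharacter.isFilterIn_fiber {δ : List 𝒜} (h : (fiber (filterOf φ) δ).Nonempty) :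
    IsFilterIn (L.famAt δ) (fiber (filterOf φ) δ) where
  subset := fiber_subset_famAt
  nonempty := h
  empty_notMem h := (nonempty_of_mem_fiber h).ne_empty rfl
  inter_mem X hX Y hY := by
    have := hφ.inter_mem_fiber (ε := []) hX (by rwa [List.append_nil])
    rwa [List.append_nil, relRange_nil] at this
  mem_of_subset X hX Y hY h := hφ.mem_fiber_of_superset hw hX hY h

end

theorem famAt_nil : L.famAt [] = L.fam := Set.ext fun _ => mem_famAt_nil

theorem IsCompleteFamily.subset_famAt {w : LWord 𝒜} {F : ℕ → Set (Set V)}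
    (hF : L.IsCompleteFamily w F) {n : ℕ} (hn : (n : ℕ∞) ≤ w.length) {A : Set V} (hA : A ∈ F n) :
    A ∈ L.famAt (w.take n) ∧ A.Nonempty := by
  have : IsFilterIn (L.famAt (w.take n)) (F n) := by
    rcases Nat.eq_zero_or_pos n with rfl | h
    · rw [LWord.take_zero, famAt_nil]
      exact hF.isFilter_zero.resolve_right fun h => by rw [h] at hA; exact hA
    · exact hF.isFilter n h hn
  refine ⟨this.subset hA, Set.nonempty_iff_ne_empty.2 ?_⟩
  rintro rfl
  exact this.empty_notMem hA

theorem fiber_ofFamily {w : LWord 𝒜} {F : ℕ → Set (Set V)} (hF : L.IsCompleteFamily w F) {n : ℕ}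
    (hn : (n : ℕ∞) ≤ w.length) : fiber (L.ofFamily w F) (w.take n) = F n := by
  ext A
  constructor
  · rintro ⟨e, ⟨m, hm, B, hB, he⟩, he'⟩
    obtain ⟨h1, rfl⟩ := he.unique he'
    have := congrArg List.length h1
    rw [LWord.length_take hm, LWord.length_take hn] at this
    exact this ▸ hB
  · intro hA
    obtain ⟨h1, h2⟩ := hF.subset_famAt hn hA
    obtain ⟨e, he⟩ := exists_isTriple h1 h2
    exact ⟨e, ⟨n, hn, A, hA, he⟩, he⟩

theorem ofFamily_congr {w : LWord 𝒜} {F F' : ℕ → Set (Set V)}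
    (h : ∀ n : ℕ, (n : ℕ∞) ≤ w.length → F n = F' n) : L.ofFamily w F = L.ofFamily w F' := by
  ext e
  exact exists_congr fun n => and_congr_right fun hn => by rw [h n hn]

theorem HasWord.eq_ofFamily {w : LWord 𝒜} {ξ : Set L.Idem} (h : L.HasWord ξ w) :
    ξ = L.ofFamily w (fun n => fiber ξ (w.take n)) := by
  obtain ⟨F, hF, rfl⟩ := h
  exact ofFamily_congr fun n hn => (fiber_ofFamily hF hn).symm

theorem HasWord.hasPrefix {w : LWord 𝒜} {ξ : Set L.Idem} (h : L.HasWord ξ w) {δ : List 𝒜}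
    (hδ : (fiber ξ δ).Nonempty) : w.HasPrefix δ := by
  obtain ⟨F, hF, rfl⟩ := h
  obtain ⟨A, e, ⟨n, hn, B, hB, he⟩, he'⟩ := hδ
  obtain ⟨rfl, -⟩ := he.unique he'
  exact LWord.hasPrefix_take hn

theorem HasWord.fiber_nonempty {w : LWord 𝒜} {ξ : Set L.Idem} (h : L.HasWord ξ w) {δ : List 𝒜}
    (hδ : δ ≠ []) (hp : w.HasPrefix δ) : (fiber ξ δ).Nonempty := by
  obtain ⟨F, hF, rfl⟩ := h
  rw [← hp.2, fiber_ofFamily hF hp.1]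
  exact (hF.isFilter _ (List.length_pos_of_ne_nil hδ) hp.1).nonempty

theorem HasWord.unique {w w' : LWord 𝒜} {ξ : Set L.Idem} (h : L.HasWord ξ w)
    (h' : L.HasWord ξ w') : w = w' :=
  LWord.ext_hasPrefix fun _ hδ => ⟨fun hp => h'.hasPrefix (h.fiber_nonempty hδ hp),
    fun hp => h.hasPrefix (h'.fiber_nonempty hδ hp)⟩

theorem isLabelled_of_fiber_nonempty {ξ : Set L.Idem} {δ : List 𝒜} (h : (fiber ξ δ).Nonempty) :
    L.IsLabelled δ := by
  obtain ⟨A, hA⟩ := h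
  exact isLabelled_of_famAt (fiber_subset_famAt hA) (nonempty_of_mem_fiber hA)

theorem isLabelledWord_of_hasPrefix {w : LWord 𝒜}
    (h : ∀ δ, δ ≠ [] → w.HasPrefix δ → L.IsLabelled δ) : L.IsLabelledWord w := by
  have h : ∀ δ, w.HasPrefix δ → L.IsLabelled δ := fun δ hp => by
    rcases eq_or_ne δ [] with rfl | hδ
    · exact isLabelled_nil
    · exact h δ hδ hp
  cases w with
  | fin α => exact h α (LWord.hasPrefix_fin.2 List.prefix_rfl)
  | inf f => exact fun n => h _ (LWord.hasPrefix_inf.2 (by simp))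

section

variable (hw : L.WeaklyLeftResolving) {φ : L.Idem → Bool} (hφ : IsCharacter φ)
include hw hφ

/-- The complete family consists of the fibres along the beginnings of `w`; nothing of the filter is
lost, as each of its elements is a triple over some beginning of `w`. -/
theorem IsCharacter.hasWord {w : LWord 𝒜}
    (h : ∀ δ, δ ≠ [] → ((fiber (filterOf φ) δ).Nonempty ↔ w.HasPrefix δ)) :
    L.HasWord (filterOf φ) w := by
  have hne : ∀ n : ℕ, 0 < n → (n : ℕ∞) ≤ w.length →
      (fiber (filterOf φ) (w.take n)).Nonempty := fun n h0 hn => by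
    refine (h _ ?_).2 (LWord.hasPrefix_take hn)
    rw [ne_eq, ← List.length_eq_zero_iff, LWord.length_take hn]
    omega
  refine ⟨fun n => fiber (filterOf φ) (w.take n), ⟨?_, ?_, ?_, ?_⟩, ?_⟩
  · exact isLabelledWord_of_hasPrefix fun δ hδ hp => isLabelled_of_fiber_nonempty ((h δ hδ).2 hp)
  · exact fun n h0 hn => hφ.isFilterIn_fiber hw (hne n h0 hn)
  · rcases Set.eq_empty_or_nonempty (fiber (filterOf φ) (w.take 0)) with h | h
    · exact Or.inr h
    · have := hφ.isFilterIn_fiber hw h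
      rw [LWord.take_zero, famAt_nil] at this
      exact Or.inl (by rwa [LWord.take_zero])
  · intro n hn
    have := hne (n + 1) n.succ_pos (by exact_mod_cast Order.add_one_le_of_lt hn)
    rw [LWord.take_succ] at this
    rw [← hφ.fMap_fiber hw this, LWord.take_succ]
    rfl
  · ext e
    constructor
    · intro he
      obtain ⟨δ, A, hA⟩ := hφ.exists_isTriple he
      have hp : w.HasPrefix δ := by
        rcases eq_or_ne δ [] with rfl | hδ
        · exact w.hasPrefix_nil
        · exact (h δ hδ).1 ⟨A, e, he, hA⟩
      refine ⟨δ.length, hp.1, A, ?_, ?_⟩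
      · beta_reduce
        rw [hp.2]
        exact ⟨e, he, hA⟩
      · rwa [hp.2]
    · rintro ⟨n, hn, A, ⟨f, hf, hA⟩, he⟩
      have : e = f := by
        obtain ⟨t, ht, h1, h2, h3⟩ := hA
        obtain ⟨t', ht', h1', h2', h3'⟩ := he
        refine Subtype.ext ?_
        rw [ht, ht', Triple.ext' (h1'.trans h1.symm) (h2'.trans h2.symm) (h3'.trans h3.symm)]
      exact this ▸ hf

theorem IsCharacter.exists_hasWord : ∃ w, L.HasWord (filterOf φ) w := by
  obtain ⟨w, h⟩ := LWord.exists_hasPrefix_iff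
    -- The empty word is adjoined by hand, because its fibre may be empty.
    (fun δ => δ = [] ∨ (fiber (filterOf φ) δ).Nonempty) (Or.inl rfl) (by
      rintro δ ε h (rfl | hε)
      · exact Or.inl (List.prefix_nil.1 h)
      · rcases eq_or_ne δ [] with rfl | hδ
        · exact Or.inl rfl
        · exact Or.inr (hφ.fiber_nonempty_of_prefix hw hδ h hε)) (by
      rintro δ ε (rfl | hδ) (rfl | hε)
      · exact Or.inl List.prefix_rfl
      · exact Or.inl List.nil_prefix
      · exact Or.inr List.nil_prefix
      · exact hφ.fiber_comparable hδ hε)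
  refine ⟨w, hφ.hasWord hw fun δ hδ => ?_⟩
  rw [← h]
  simp [hδ]

end

end LabelledSpace

namespace LabelledSpace

open LabelledGraph

variable {V D 𝒜 : Type*} {L : LabelledSpace V D 𝒜}

/-! The action on characters -/

/-- The idempotent `s* s`. -/
noncomputable def dom (s : L.S) : L.Idem := ⟨star s * s, S.isIdem_star_mul_self s⟩

theorem dom_tri_isTriple (t : L.Triple) : (dom (.tri t)).IsTriple t.right t.set := by
  have h := Triple.mul_of_left_eq (s := t.adj) (t := t) (ε := []) (by simp [Triple.adj])
  rcases h with ⟨-, h⟩ | ⟨u, h, h1, h2, h3⟩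
  · rw [relRange_nil] at h
    exact absurd ((Set.inter_self _).symm.trans h) t.nonempty.ne_empty
  · refine ⟨u, h, h1.trans (List.append_nil _), h2.trans ?_, h3⟩
    rw [relRange_nil]
    exact Set.inter_self _

theorem set_mem_fiber_iff {φ : L.Idem → Bool} {t : L.Triple} :
    t.set ∈ fiber (filterOf φ) t.right ↔ φ (dom (.tri t)) = true := by
  have h := dom_tri_isTriple t
  refine ⟨?_, fun hd => ⟨_, hd, h⟩⟩
  rintro ⟨e, he, e1, he1, h1, h2, h3⟩
  obtain ⟨t', h', k1, k2, k3⟩ := h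
  have : e = dom (.tri t) := Subtype.ext <| by
    rw [he1, h', Triple.ext' (h1.trans k1.symm) (h2.trans k2.symm) (h3.trans k3.symm)]
  exact this ▸ he

theorem S.IsIdem.star_eq {e : L.S} (he : e.IsIdem) : star e = e := by
  rcases e with _ | t
  · rfl
  · have he' : t.left = t.right := he
    exact congrArg S.tri (Triple.ext' he'.symm rfl he')

theorem act_mono {φ ψ : L.Idem → Bool} (h : φ ≤ ψ) (s : L.S) : act s φ ≤ act s ψ :=
  fun _ => h _

theorem IsCharacter.act_idem {φ : L.Idem → Bool} (hφ : IsCharacter φ) {e : L.Idem}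
    (he : φ e = true) : act e.1 φ = φ := by
  funext f
  have h : act e.1 φ f = φ (e * f * e) := by
    refine congrArg φ (Subtype.ext ?_)
    simp only [e.2.star_eq]
    rfl
  rw [h, hφ.map_mul, hφ.map_mul, he]
  simp

section

variable (hw : L.WeaklyLeftResolving)
include hw

theorem act_mul (s t : L.S) (φ : L.Idem → Bool) : act (s * t) φ = act s (act t φ) := by
  funext e
  refine congrArg φ (Subtype.ext ?_)
  simp only [S.star_mul hw, S.mul_assoc hw]

theorem act_dom (s t : L.S) (φ : L.Idem → Bool) : act t φ (dom s) = φ (dom (s * t)) := by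
  refine congrArg φ (Subtype.ext ?_)
  simp only [dom, S.star_mul hw, S.mul_assoc hw]

theorem dom_star_mul_self (s : L.S) : dom (star s * s) = dom s := by
  refine Subtype.ext ?_
  simp only [dom, S.star_mul hw, S.star_star]
  rw [(S.isIdem_star_mul_self s).mul_self hw]

theorem act_dom_star (t : L.S) (φ : L.Idem → Bool) : act t φ (dom (star t)) = φ (dom t) := by
  rw [act_dom hw, dom_star_mul_self hw]

theorem IsCharacter.act_congr {φ : L.Idem → Bool} (hφ : IsCharacter φ) {s t : L.S} {e : L.Idem}
    (he : φ e = true) (h : s * e.1 = t * e.1) : act s φ = act t φ := by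
  rw [← hφ.act_idem he, ← act_mul hw, ← act_mul hw, h]

theorem IsCharacter.act_star_act {φ : L.Idem → Bool} (hφ : IsCharacter φ) {t : L.S}
    (ht : φ (dom t) = true) : act (star t) (act t φ) = φ := by
  rw [← act_mul hw]
  exact hφ.act_idem ht

theorem IsCharacter.act {φ : L.Idem → Bool} (hφ : IsCharacter φ) {t : L.S}
    (ht : φ (dom t) = true) : IsCharacter (act t φ) where
  map_zero := by
    rw [← hφ.map_zero]
    refine congrArg φ (Subtype.ext ?_)
    change star t * 0 * t = 0
    rw [S.mul_zero, S.zero_mul]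
  map_mul e f := by
    -- The identity t*(ef)t = (t*et)(t*ft) holds for partial bijections: both sides restrict to the
    -- points whose image under t lies in the domains of e and f.
    refine (congrArg φ (Subtype.ext (S.rel_injective fun p q => ?_))).trans (hφ.map_mul _ _)
    change (star t * (e.1 * f.1) * t).rel p q ↔ ((star t * e.1 * t) * (star t * f.1 * t)).rel p q
    simp only [S.rel_mul hw, S.rel_star]
    constructor
    · rintro ⟨m, ⟨n, h1, k, h2, h3⟩, h4⟩
      obtain rfl := e.2.eq_of_rel h2
      obtain rfl := f.2.eq_of_rel h3
      exact ⟨p, ⟨n, ⟨n, h1, h2⟩, h1⟩, n, ⟨n, h1, h3⟩, h4⟩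
    · rintro ⟨k, ⟨m, ⟨n, h1, h2⟩, h3⟩, m', ⟨n', h4, h5⟩, h6⟩
      obtain rfl := e.2.eq_of_rel h2
      obtain rfl := f.2.eq_of_rel h5
      obtain rfl := S.rel_unique_right h1 h3
      obtain rfl := S.rel_unique_left h1 h4
      exact ⟨n, ⟨n, h1, n, h2, h5⟩, h6⟩
  ne_zero := ⟨_, (act_dom_star hw t φ).trans ht⟩

/-- θ_t and θ_{t*} are monotone and mutually inverse on the characters in their domains, so a
character above θ_t(ψ) pulls back to one above ψ. -/
theorem maximal_act {ψ : L.Idem → Bool} (hψ : Maximal IsCharacter ψ) {t : L.S}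
    (ht : ψ (dom t) = true) : Maximal IsCharacter (act t ψ) := by
  refine ⟨hψ.prop.act hw ht, fun χ hχ hle => ?_⟩
  have hd : χ (dom (star t)) = true := by
    have := hle (dom (star t))
    rw [act_dom_star hw, ht] at this
    exact Bool.eq_true_of_true_le this
  have h1 : ψ ≤ act (star t) χ := by
    have := act_mono hle (star t)
    rwa [hψ.prop.act_star_act hw ht] at this
  have h2 := act_mono (hψ.le_of_ge (hχ.act hw hd) h1) t
  have h3 := hχ.act_star_act hw hd
  rw [S.star_star] at h3
  rwa [h3] at h2

/-- The domain of θ_t is open, so maximal characters inside it approximate φ; θ_t is continuous and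
keeps them maximal. -/
theorem act_mem_tightSpectrum {φ : L.Idem → Bool} (hφ : φ ∈ L.tightSpectrum) {t : L.S}
    (ht : φ (dom t) = true) : act t φ ∈ L.tightSpectrum := by
  refine ⟨hφ.1.act hw ht, ?_⟩
  have hopen : IsOpen {ψ : L.Idem → Bool | ψ (dom t) = true} :=
    IsOpen.preimage (f := fun ψ : L.Idem → Bool => ψ (dom t)) (continuous_apply (dom t))
      (isOpen_discrete {true})
  have hcont : Continuous (act t : (L.Idem → Bool) → L.Idem → Bool) :=
    continuous_pi fun e => continuous_apply _
  exact map_mem_closure hcont (hopen.closure_inter ⟨hφ.2, ht⟩)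
    fun ψ hψ => maximal_act hw hψ.1 hψ.2

end

variable {φ : L.Idem → Bool} (hφ : IsCharacter φ)
include hφ

/-- For t = (α, A, β) one has t*(αε, B, αε)t = (βε, r(A,ε) ∩ B, βε), read as zero if the set is
empty. -/
theorem IsCharacter.mem_fiber_act_iff {t : L.Triple} {ε : List 𝒜} {B : Set V} :
    B ∈ fiber (filterOf (LabelledSpace.act (.tri t) φ)) (t.left ++ ε) ↔
      B ∈ L.famAt (t.left ++ ε) ∧
        L.relRange t.set ε ∩ B ∈ fiber (filterOf φ) (t.right ++ ε) := by
  have key : ∀ {e : L.Idem}, e.IsTriple (t.left ++ ε) B →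
      (LabelledSpace.act (.tri t) φ e = true ↔
        L.relRange t.set ε ∩ B ∈ fiber (filterOf φ) (t.right ++ ε)) := by
    intro e he
    set g : L.Idem := ⟨star (.tri t) * e.1 * .tri t, e.2.conj _⟩ with hg
    change φ g = true ↔ _
    obtain ⟨t', ht', h1, rfl, h2⟩ := he
    have hg1 : g.1 = S.tri t.adj * S.tri t' * S.tri t := by rw [← ht']; rfl
    have hg' : (L.relRange t.set ε ∩ t'.set = ∅ ∧ g = 0) ∨
        g.IsTriple (t.right ++ ε) (L.relRange t.set ε ∩ t'.set) := by
      rcases Triple.mul_of_left_eq (s := t.adj) (t := t') (ε := ε) h1 with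
        ⟨h, h'⟩ | ⟨u, h, u1, u2, u3⟩
      · refine Or.inl ⟨h', Subtype.ext ?_⟩
        rw [hg1, h, S.zero_mul]
        rfl
      · rw [h] at hg1
        have u2 : u.set = L.relRange t.set ε ∩ t'.set := u2
        rcases Triple.mul_of_right_eq (s := u) (t := t) (ε := ε) (u3.trans h2) with
          ⟨k, k'⟩ | ⟨v, k, v1, v2, v3⟩
        · refine absurd k' ?_
          rw [Set.inter_eq_left.2 (u2 ▸ Set.inter_subset_left)]
          exact u.nonempty.ne_empty
        · refine Or.inr ⟨v, hg1.trans k, v1.trans u1, ?_, v3⟩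
          rw [v2, Set.inter_eq_left.2 (u2 ▸ Set.inter_subset_left), u2]
    rcases hg' with ⟨h, h'⟩ | h
    · rw [h, h', hφ.map_zero]
      exact ⟨fun h => absurd h Bool.false_ne_true,
        fun h => ((nonempty_of_mem_fiber h).ne_empty rfl).elim⟩
    · refine ⟨fun hg => ⟨g, hg, h⟩, ?_⟩
      rintro ⟨f, hf, hf'⟩
      have : f = g := by
        obtain ⟨a, ha, a1, a2, a3⟩ := h
        obtain ⟨b, hb, b1, b2, b3⟩ := hf'
        refine Subtype.ext ?_
        rw [ha, hb, Triple.ext' (b1.trans a1.symm) (b2.trans a2.symm) (b3.trans a3.symm)]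
      exact this ▸ hf
  constructor
  · rintro ⟨e, he, he'⟩
    exact ⟨he'.mem_famAt, (key he').1 he⟩
  · rintro ⟨hB, h⟩
    obtain ⟨e, he⟩ := LabelledSpace.exists_isTriple hB
      ((nonempty_of_mem_fiber h).mono Set.inter_subset_right)
    exact ⟨e, (key he).2 h, he⟩

theorem IsCharacter.fiber_act_nonempty_iff (hw : L.WeaklyLeftResolving) {t : L.Triple}
    (ht : φ (dom (.tri t)) = true) {ε : List 𝒜} :
    (fiber (filterOf (LabelledSpace.act (.tri t) φ)) (t.left ++ ε)).Nonempty ↔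
      (fiber (filterOf φ) (t.right ++ ε)).Nonempty := by
  constructor
  · rintro ⟨B, hB⟩
    exact ⟨_, (hφ.mem_fiber_act_iff.1 hB).2⟩
  · intro h
    have h' := hφ.relRange_mem_fiber hw (set_mem_fiber_iff.2 ht) h
    refine ⟨L.relRange t.set ε, hφ.mem_fiber_act_iff.2
      ⟨relRange_mem_famAt t.mem_left (nonempty_of_mem_fiber h'), ?_⟩⟩
    rwa [Set.inter_self]

/-- Beginnings that extend `t.left` correspond to those of the old word that extend `t.right`;
shorter ones are beginnings of `t.left`, whose fibre is non-empty. -/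
theorem IsCharacter.hasWord_act (hw : L.WeaklyLeftResolving) {t : L.Triple}
    (ht : φ (dom (.tri t)) = true) {w : LWord 𝒜} (h : L.HasWord (filterOf φ) (w.append t.right)) :
    L.HasWord (filterOf (LabelledSpace.act (.tri t) φ)) (w.append t.left) := by
  have hη := hφ.act hw ht
  have ht' := set_mem_fiber_iff.2 ht
  have hl : (fiber (filterOf (LabelledSpace.act (.tri t) φ)) t.left).Nonempty := by
    have := (hφ.fiber_act_nonempty_iff hw ht (ε := [])).2 ⟨t.set, by rwa [List.append_nil]⟩
    rwa [List.append_nil] at this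
  refine hη.hasWord hw fun δ hδ => ?_
  have key : ∀ ε, (fiber (filterOf (LabelledSpace.act (.tri t) φ)) (t.left ++ ε)).Nonempty ↔
      (w.append t.left).HasPrefix (t.left ++ ε) := fun ε => by
    rw [hφ.fiber_act_nonempty_iff hw ht, LWord.hasPrefix_append_iff]
    constructor
    · intro hne
      exact LWord.hasPrefix_append_iff.1 (h.hasPrefix hne)
    · intro hp
      rcases eq_or_ne (t.right ++ ε) [] with h0 | h0
      · rw [List.append_eq_nil_iff] at h0
        rw [h0.2, List.append_nil]
        exact ⟨_, ht'⟩
      · exact h.fiber_nonempty h0 (LWord.hasPrefix_append_iff.2 hp)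
  constructor
  · intro hne
    rcases hη.fiber_comparable hne hl with hp | ⟨ε, rfl⟩
    · exact (w.hasPrefix_append_self _).of_prefix hp
    · exact (key ε).1 hne
  · intro hp
    rcases hp.comparable (w.hasPrefix_append_self _) with hp' | ⟨ε, rfl⟩
    · exact hη.fiber_nonempty_of_prefix hw hδ hp' hl
    · exact (key ε).2 hp

end LabelledSpace

namespace LabelledSpace

open LabelledGraph

variable {V D 𝒜 : Type*} {L : LabelledSpace V D 𝒜}

/-- The triple `(α, A, β)`. -/
def Triple.ofSet {α β : List 𝒜} {A : Set V} (hα : A ∈ L.famAt α) (hβ : A ∈ L.famAt β)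
    (hA : A.Nonempty) : L.Triple :=
  ⟨α, A, β, isLabelled_of_famAt hα hA, isLabelled_of_famAt hβ hA, hα, hβ, hA⟩

theorem Triple.mul_eq_tri {s t u : L.Triple} (h : t.left = s.right) (h1 : u.left = s.left)
    (h2 : u.set = s.set ∩ t.set) (h3 : u.right = t.right) : S.tri s * S.tri t = .tri u := by
  rcases Triple.mul_of_left_eq (s := s) (t := t) (ε := []) (by simpa using h) with
    ⟨-, h'⟩ | ⟨v, hv, v1, v2, v3⟩
  · rw [relRange_nil, ← h2] at h'
    exact absurd h' u.nonempty.ne_empty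
  · rw [hv, Triple.ext' (v1.trans ?_) (v2.trans ?_) (v3.trans h3.symm)]
    · rw [List.append_nil, h1]
    · rw [relRange_nil, h2]

theorem append_nil_eq (w : LWord 𝒜) : w.append [] = w := by
  cases w <;> simp [LWord.append]

/-! Cutting and gluing as actions of triples -/

theorem IsCharacter.fiber_act_eq_gMap {φ : L.Idem → Bool} (hφ : IsCharacter φ) {t : L.Triple} (ht : φ (dom (.tri t)) = true)
    (hr : t.right = []) (hs : t.set = L.range t.left) (ε : List 𝒜) :
    L.gMap t.left ε (fiber (filterOf φ) ε) =
      fiber (filterOf (LabelledSpace.act (.tri t) φ)) (t.left ++ ε) := by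
  ext B
  rw [hφ.mem_fiber_act_iff, hr, List.nil_append, hs, ← range_append]
  constructor
  · rintro ⟨C, hC, rfl⟩
    have hA := set_mem_fiber_iff.2 ht
    rw [hr, hs] at hA
    have h := hφ.inter_mem_fiber (ε := ε) hA hC
    rw [← range_append, List.nil_append, Set.inter_comm] at h
    refine ⟨⟨(fiber_subset_famAt h).1, Set.inter_subset_right⟩, ?_⟩
    rwa [Set.inter_eq_right.2 Set.inter_subset_right]
  · rintro ⟨hB, h⟩
    rw [Set.inter_eq_right.2 hB.2] at h
    exact ⟨B, h, (Set.inter_eq_left.2 hB.2).symm⟩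

section

variable (hw : L.WeaklyLeftResolving) {φ : L.Idem → Bool} (hφ : IsCharacter φ)
include hw hφ

/-- The action gives the C with r(A,ε) ∩ C in the old fibre. As r(A,ε) itself lies in that fibre,
this means that C contains a member of it. -/
theorem IsCharacter.fiber_act_eq_hMap {t : L.Triple} (ht : φ (dom (.tri t)) = true)
    (hl : t.left = []) (ε : List 𝒜) :
    fiber (filterOf (LabelledSpace.act (.tri t) φ)) ε =
      L.hMap ε (fiber (filterOf φ) (t.right ++ ε)) := by
  ext B
  have h := hφ.mem_fiber_act_iff (t := t) (ε := ε) (B := B)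
  rw [hl, List.nil_append] at h
  rw [h]
  refine and_congr_right fun hB => ⟨fun h => ⟨_, h, Set.inter_subset_right⟩, ?_⟩
  rintro ⟨C, hC, hCB⟩
  have hr := hφ.relRange_mem_fiber hw (set_mem_fiber_iff.2 ht) ⟨C, hC⟩
  exact hφ.mem_fiber_of_superset hw (hφ.inter_mem_fiber (set_mem_fiber_iff.2 ht) hC)
    (inter_mem_famAt (fiber_subset_famAt hr) hB.1) (Set.inter_subset_inter_right _ hCB)

theorem IsCharacter.cut_eq_act {t : L.Triple} (ht : φ (dom (.tri t)) = true) (hl : t.left = [])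
    {w : LWord 𝒜} (h : L.HasWord (filterOf φ) (w.append t.right)) :
    L.cut t.right w (filterOf φ) = filterOf (LabelledSpace.act (.tri t) φ) := by
  -- Cutting off the empty word is the identity by definition, and `t` is then an idempotent of the
  -- filter.
  by_cases hr : t.right = []
  · have he : (S.tri t).IsIdem := hl.trans hr.symm
    have hd : dom (.tri t) = ⟨.tri t, he⟩ := Subtype.ext <| by
      change star (S.tri t) * S.tri t = .tri t
      rw [he.star_eq, he.mul_self hw]
    rw [cut, if_pos hr]
    exact congrArg filterOf (hφ.act_idem (e := ⟨.tri t, he⟩) (hd ▸ ht)).symm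
  · have hword := hφ.hasWord_act hw ht h
    rw [hl, append_nil_eq] at hword
    rw [cut, if_neg hr, hword.eq_ofFamily]
    exact ofFamily_congr fun n _ => (hφ.fiber_act_eq_hMap hw ht hl _).symm

theorem IsCharacter.glue_eq_act {t : L.Triple} (ht : φ (dom (.tri t)) = true) (hr : t.right = [])
    (hs : t.set = L.range t.left) (hl : t.left ≠ []) {w : LWord 𝒜}
    (h : L.HasWord (filterOf φ) w) :
    L.glue t.left w (filterOf φ) = filterOf (LabelledSpace.act (.tri t) φ) := by
  have hη := hφ.act hw ht
  have hword := hφ.hasWord_act hw ht (w := w) (by rwa [hr, append_nil_eq])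
  have hg := hφ.fiber_act_eq_gMap ht hr hs
  have hne : ∀ ε, w.HasPrefix ε →
      (fiber (filterOf (LabelledSpace.act (.tri t) φ)) (t.left ++ ε)).Nonempty := fun ε hε =>
    hword.fiber_nonempty (by simp [hl]) (LWord.hasPrefix_append_iff.2 hε)
  have hf : ∀ (n : ℕ) (ε : List 𝒜), w.HasPrefix ε →
      L.fMap (t.left.take n) (t.left.drop n ++ ε)
        (fiber (filterOf (LabelledSpace.act (.tri t) φ)) (t.left ++ ε)) =
      fiber (filterOf (LabelledSpace.act (.tri t) φ)) (t.left.take n) := fun n ε hε => by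
    have he : t.left ++ ε = t.left.take n ++ (t.left.drop n ++ ε) := by
      rw [← List.append_assoc, List.take_append_drop]
    have := hne ε hε
    rw [he] at this ⊢
    exact hη.fMap_fiber hw this
  rw [glue, if_neg hl, hword.eq_ofFamily]
  refine ofFamily_congr fun n hn => ?_
  rw [LWord.length_append] at hn
  unfold glueFamily
  split_ifs with h1 h2 h2
  · rw [LWord.take_append_of_le h2.le, hg]
    have := hf n [] w.hasPrefix_nil
    rwa [List.append_nil] at this
  -- If the glued word ends with `t.left`, only the last index remains.
  · have hn' : n = t.left.length := by
      rw [h1] at hn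
      have : n ≤ t.left.length := by simpa [LWord.length] using hn
      omega
    rw [hg, hn', LWord.take_append_of_le le_rfl, List.take_length, List.append_nil]
  · rw [LWord.take_append_of_le h2, hg]
    -- The remaining word is not empty, so its first letter exists.
    refine hf n _ (LWord.hasPrefix_take ?_)
    cases w with
    | fin α =>
      have : α ≠ [] := fun h => h1 (by rw [h])
      have := List.length_pos_of_ne_nil this
      simpa [LWord.length] using Nat.one_le_iff_ne_zero.2 this.ne'
    | inf f => simp [LWord.length]
  · obtain ⟨m, rfl⟩ := Nat.exists_eq_add_of_lt (not_le.1 h2)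
    rw [hg, add_assoc, LWord.take_append_add, Nat.add_sub_cancel_left]

/-- Cutting off the beginning `γ` and gluing on `β` is the action of `(β, A, γ)`. -/
theorem IsCharacter.glue_cut_eq_act {t : L.Triple} (ht : φ (dom (.tri t)) = true) {w : LWord 𝒜}
    (h : L.HasWord (filterOf φ) (w.append t.right)) :
    L.glue t.left w (L.cut t.right w (filterOf φ)) =
      filterOf (LabelledSpace.act (.tri t) φ) := by
  by_cases hl : t.left = []
  · rw [hφ.cut_eq_act hw ht hl h, glue, if_pos hl]
  · have hnil : t.set ∈ L.famAt [] := mem_famAt_nil.2 t.mem_left.1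
    have hrange : L.range t.left ∈ L.fam := L.range_mem _ hl t.left_labelled
    -- The factors are (ω, A, γ) and (β, r(β), ω), with middle set r(β) ∩ A = A. The second exists
    -- only for β ≠ ω, which explains the case distinction.
    let t₁ : L.Triple := Triple.ofSet hnil t.mem_right t.nonempty
    let t₂ : L.Triple := Triple.ofSet (α := t.left) (β := []) ⟨hrange, subset_rfl⟩
      (mem_famAt_nil.2 hrange) (t.nonempty.mono t.mem_left.2)
    have ht₁ : φ (dom (.tri t₁)) = true := set_mem_fiber_iff.1 ((set_mem_fiber_iff (t := t)).2 ht)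
    have hmul : S.tri t₂ * S.tri t₁ = .tri t :=
      Triple.mul_eq_tri rfl rfl (Set.inter_eq_right.2 t.mem_left.2).symm rfl
    have hword : L.HasWord (filterOf (LabelledSpace.act (.tri t₁) φ)) w := by
      have := hφ.hasWord_act hw ht₁ h
      rwa [show t₁.left = [] from rfl, append_nil_eq] at this
    have ht₂ : LabelledSpace.act (.tri t₁) φ (dom (.tri t₂)) = true := by
      rw [act_dom hw, hmul, ht]
    have h1 := hφ.cut_eq_act hw ht₁ rfl h
    have h2 := (hφ.act hw ht₁).glue_eq_act hw ht₂ rfl rfl hl hword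
    rw [← act_mul hw, hmul] at h2
    exact (congrArg (L.glue t.left w) h1).trans h2

theorem IsCharacter.cut_mem_glueDomain (hmem : φ ∈ L.tightSpectrum) {t : L.Triple}
    (ht : φ (dom (.tri t)) = true) {w : LWord 𝒜}
    (h : L.HasWord (filterOf φ) (w.append t.right)) {β : List 𝒜} (hβ : t.set ∈ L.famAt β) :
    L.cut t.right w (filterOf φ) ∈ L.glueDomain β w := by
  let t₁ : L.Triple := Triple.ofSet (mem_famAt_nil.2 t.mem_left.1) t.mem_right t.nonempty
  have ht₁ : φ (dom (.tri t₁)) = true := set_mem_fiber_iff.1 ((set_mem_fiber_iff (t := t)).2 ht)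
  have h1 : L.cut t.right w (filterOf φ) = _ := hφ.cut_eq_act hw ht₁ rfl h
  have hword := hφ.hasWord_act hw ht₁ h
  rw [show t₁.left = [] from rfl, append_nil_eq] at hword
  rw [h1]
  refine ⟨⟨⟨_, act_mem_tightSpectrum hw hmem ht₁, rfl⟩, hword⟩, fun hne => ?_⟩
  rw [hφ.fiber_act_eq_hMap hw ht₁ rfl, List.append_nil]
  exact ⟨mem_famAt_nil.2 (L.range_mem _ hne (isLabelled_of_famAt hβ t.nonempty)), t.set,
    (set_mem_fiber_iff (t := t)).2 ht, hβ.2⟩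

/-- Both sides are actions of triples, and (ω, A, β)(β, A, γ) = (ω, A, γ). -/
theorem IsCharacter.cut_act {t : L.Triple} (ht : φ (dom (.tri t)) = true) {w : LWord 𝒜}
    (h : L.HasWord (filterOf φ) (w.append t.right)) :
    L.cut t.left w (filterOf (LabelledSpace.act (.tri t) φ)) =
      L.cut t.right w (filterOf φ) := by
  have hnil : t.set ∈ L.famAt [] := mem_famAt_nil.2 t.mem_left.1
  let t₁ : L.Triple := Triple.ofSet hnil t.mem_right t.nonempty
  let t₂ : L.Triple := Triple.ofSet hnil t.mem_left t.nonempty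
  have hmul : S.tri t₂ * S.tri t = .tri t₁ :=
    Triple.mul_eq_tri rfl rfl (Set.inter_self _).symm rfl
  have ht₁ : φ (dom (.tri t₁)) = true := set_mem_fiber_iff.1 ((set_mem_fiber_iff (t := t)).2 ht)
  have ht₂ : LabelledSpace.act (.tri t) φ (dom (.tri t₂)) = true := by
    rw [act_dom hw, hmul, ht₁]
  have h1 := hφ.cut_eq_act hw ht₁ rfl h
  have h2 := (hφ.act hw ht).cut_eq_act hw ht₂ rfl (hφ.hasWord_act hw ht h)
  rw [← act_mul hw, hmul] at h2
  exact h2.trans h1.symm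

theorem IsCharacter.range_mem_fiber_of_hasWord {α : List 𝒜} (hα : α ≠ []) {w : LWord 𝒜}
    (h : L.HasWord (filterOf φ) (w.append α)) : L.range α ∈ fiber (filterOf φ) α :=
  hφ.range_mem_fiber hw hα (ε := [])
    (by rw [List.append_nil]; exact h.fiber_nonempty hα (w.hasPrefix_append_self α))

theorem IsCharacter.fiber_cut_nil {α : List 𝒜} (hα : α ≠ []) {w : LWord 𝒜}
    (h : L.HasWord (filterOf φ) (w.append α)) :
    fiber (L.cut α w (filterOf φ)) [] = L.hMap [] (fiber (filterOf φ) α) := by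
  have hr := hφ.range_mem_fiber_of_hasWord hw hα h
  have hf := fiber_subset_famAt hr
  let t : L.Triple := Triple.ofSet (mem_famAt_nil.2 hf.1) hf (nonempty_of_mem_fiber hr)
  have ht : φ (dom (.tri t)) = true := set_mem_fiber_iff.1 hr
  have h1 : L.cut α w (filterOf φ) = _ := hφ.cut_eq_act hw ht rfl h
  rw [h1, hφ.fiber_act_eq_hMap hw ht rfl, List.append_nil]
  rfl

end

/-- For α ≠ ω, r(α) lies in the zeroth set of the common cut filter, so some member of the fibre at
β is contained in r(α), and it is contained in r(β) anyway. If both words are empty, the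
intersection is the set of all vertices, which may be missing from the family. -/
theorem inter_range_mem_fiber (hw : L.WeaklyLeftResolving) {φ ψ : L.Idem → Bool}
    (hφ : IsCharacter φ) (hψ : IsCharacter ψ) {α β : List 𝒜} (hne : α ≠ [] ∨ β ≠ [])
    {w : LWord 𝒜} (h : L.HasWord (filterOf φ) (w.append α))
    (h' : L.HasWord (filterOf ψ) (w.append β))
    (hc : L.cut α w (filterOf φ) = L.cut β w (filterOf ψ)) :
    L.range α ∩ L.range β ∈ fiber (filterOf ψ) β := by
  obtain ⟨C, hC, hCα⟩ : ∃ C ∈ fiber (filterOf ψ) β, C ⊆ L.range α := by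
    by_cases hα : α = []
    · rw [hα, range_nil]
      exact ⟨_, hψ.range_mem_fiber_of_hasWord hw (hne.resolve_left (not_not.2 hα)) h',
        Set.subset_univ _⟩
    · have hr := hφ.range_mem_fiber_of_hasWord hw hα h
      have hr' : L.range α ∈ fiber (L.cut β w (filterOf ψ)) [] := by
        rw [← hc, hφ.fiber_cut_nil hw hα h]
        exact ⟨mem_famAt_nil.2 (fiber_subset_famAt hr).1, _, hr, subset_rfl⟩
      by_cases hβ : β = []
      · rw [cut, if_pos hβ] at hr'
        exact ⟨_, hβ ▸ hr', subset_rfl⟩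
      · rw [hψ.fiber_cut_nil hw hβ h'] at hr'
        exact hr'.2
  refine hψ.mem_fiber_of_superset hw hC ⟨?_, Set.inter_subset_right⟩
    (Set.subset_inter hCα (fiber_subset_famAt hC).2)
  by_cases hα : α = []
  · have hβ := hne.resolve_left (not_not.2 hα)
    rw [hα, range_nil, Set.univ_inter]
    exact (fiber_subset_famAt (hψ.range_mem_fiber_of_hasWord hw hβ h')).1
  · have h1 := (fiber_subset_famAt (hφ.range_mem_fiber_of_hasWord hw hα h)).1
    by_cases hβ : β = []
    · rwa [hβ, range_nil, Set.inter_univ]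
    · exact L.inter_mem _ h1 _ (fiber_subset_famAt (hψ.range_mem_fiber_of_hasWord hw hβ h')).1

/-- Two filters with words `αw` and `βw` that agree after cutting are related by a triple. -/
theorem exists_act_eq (hw : L.WeaklyLeftResolving) {φ ψ : L.Idem → Bool}
    (hφ : IsCharacter φ) (hψ : IsCharacter ψ) {α β : List 𝒜}
    {w : LWord 𝒜} (h : L.HasWord (filterOf φ) (w.append α))
    (h' : L.HasWord (filterOf ψ) (w.append β))
    (hc : L.cut α w (filterOf φ) = L.cut β w (filterOf ψ)) :
    ∃ t : L.Triple, (t.left.length : ℤ) - t.right.length = α.length - β.length ∧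
      ψ (dom (.tri t)) = true ∧ filterOf (act (.tri t) ψ) = filterOf φ := by
  by_cases hne : α ≠ [] ∨ β ≠ []
  · have hA := inter_range_mem_fiber hw hφ hψ hne h h' hc
    have hA' := inter_range_mem_fiber hw hψ hφ hne.symm h' h hc.symm
    rw [Set.inter_comm] at hA'
    have hβ := fiber_subset_famAt hA
    have hα := fiber_subset_famAt hA'
    have hn := nonempty_of_mem_fiber hA
    have hnil := mem_famAt_nil.2 hα.1
    let t : L.Triple := Triple.ofSet hα hβ hn
    let t₁ : L.Triple := Triple.ofSet hnil hα hn
    let t₂ : L.Triple := Triple.ofSet hnil hβ hn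
    have ht : ψ (dom (.tri t)) = true := set_mem_fiber_iff.1 hA
    have ht₁ : φ (dom (.tri t₁)) = true := set_mem_fiber_iff.1 hA'
    have ht₂ : ψ (dom (.tri t₂)) = true := set_mem_fiber_iff.1 hA
    refine ⟨t, rfl, ht, ?_⟩
    have h1 : L.cut α w (filterOf φ) = _ := hφ.cut_eq_act hw ht₁ rfl h
    have h2 : L.cut β w (filterOf ψ) = _ := hψ.cut_eq_act hw ht₂ rfl h'
    have h3 : act (.tri t₁) φ = act (.tri t₂) ψ := by
      rw [h1, h2] at hc
      funext e
      exact Bool.eq_iff_iff.2 (Set.ext_iff.1 hc e)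
    -- Undoing the cut of α after the cut of β: t = t₁* t₂.
    have hmul : star (S.tri t₁) * S.tri t₂ = .tri t :=
      Triple.mul_eq_tri (s := t₁.adj) rfl rfl (Set.inter_self _).symm rfl
    rw [← hmul, act_mul hw, ← h3, hφ.act_star_act hw ht₁]
  · push Not at hne
    obtain ⟨rfl, rfl⟩ := hne
    rw [cut, cut, if_pos rfl, if_pos rfl] at hc
    -- Here the filters coincide, and any idempotent of the filter serves as the triple.
    obtain ⟨e, he⟩ := hψ.ne_zero
    rcases h : e.1 with _ | t
    · exact absurd (Subtype.ext h) (hψ.ne_zero_of_eq_true he)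
    · have hi : (S.tri t).IsIdem := h ▸ e.2
      have hd : dom (.tri t) = e := Subtype.ext <| by
        change star (S.tri t) * S.tri t = e.1
        rw [hi.star_eq, hi.mul_self hw, h]
      refine ⟨t, ?_, hd ▸ he, ?_⟩
      · rw [show t.left = t.right from hi]
        simp
      · rw [← h, hψ.act_idem he, hc]

end LabelledSpace

/-! ### Transport of groupoid structures -/

namespace AlgGroupoid

/-- The groupoid structure transported along a bijection. -/
def transport {G H : Type*} (e : G ≃ H) (ℋ : AlgGroupoid H) : AlgGroupoid G where
  Comp g h := ℋ.Comp (e g) (e h)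
  mul _ _ hgh := e.symm (ℋ.mul _ _ hgh)
  inv g := e.symm (ℋ.inv (e g))
  inv_inv g := by simp [ℋ.inv_inv]
  assoc g h k hgh hhk := by
    obtain ⟨h1, h2, h3⟩ := ℋ.assoc _ _ _ hgh hhk
    refine ⟨by simpa using h1, by simpa using h2, ?_⟩
    simpa using h3
  inv_comp g := by simpa using ℋ.inv_comp (e g)
  comp_inv g := by simpa using ℋ.comp_inv (e g)
  inv_mul g h hgh := by
    obtain ⟨h1, h2⟩ := ℋ.inv_mul _ _ hgh
    refine ⟨by simpa using h1, ?_⟩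
    rw [Equiv.symm_apply_eq]
    simpa using h2
  mul_inv g h hgh := by
    obtain ⟨h1, h2⟩ := ℋ.mul_inv _ _ hgh
    refine ⟨by simpa using h1, ?_⟩
    rw [Equiv.symm_apply_eq]
    simpa using h2

/-- A bijection is an isomorphism from the transported groupoid. -/
def transportIso {G H : Type*} (e : G ≃ H) (ℋ : AlgGroupoid H) : (transport e ℋ).Iso ℋ where
  toEquiv := e
  comp_iff _ _ := Iff.rfl
  map_mul _ _ _ := e.apply_symm_apply _
  map_inv _ := e.apply_symm_apply _

end AlgGroupoid

/-! ### Germs, the boundary groupoid and the isomorphism -/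

namespace LabelledSpace

open LabelledGraph

variable {V D 𝒜 : Type*} {L : LabelledSpace V D 𝒜}

/-- The degree `|α| - |β|` of `(α, A, β)`. -/
def S.degree : L.S → ℤ
  | .zero => 0
  | .tri t => (t.left.length : ℤ) - t.right.length

/-- The degree of zero is a default value, so additivity needs a non-zero product. -/
theorem S.degree_mul {s t : L.S} (h : s * t ≠ 0) : (s * t).degree = s.degree + t.degree := by
  rcases s with _ | s
  · exact absurd rfl h
  rcases t with _ | t
  · exact absurd rfl h
  rcases s.mul_cases t with h' | ⟨u, h', hu⟩
  · exact absurd h' h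
  change (s.mul t).degree = _
  rw [h']
  simp only [S.degree]
  rcases hu with ⟨δ, h1, h2, h3⟩ | ⟨δ, h1, h2, h3⟩ <;>
    rw [h1, h2, h3, List.length_append, List.length_append] <;> push_cast <;> ring

theorem S.degree_star (s : L.S) : (star s).degree = -s.degree := by
  rcases s with _ | s
  · rfl
  · exact (neg_sub _ _).symm

theorem S.IsIdem.degree_eq {e : L.S} (he : e.IsIdem) : e.degree = 0 := by
  rcases e with _ | t
  · rfl
  · have he' : t.left = t.right := he
    simp [S.degree, he']

theorem IsCharacter.elt_ne_zero {φ : L.Idem → Bool} (hφ : IsCharacter φ) {s : L.S}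
    (h : φ (dom s) = true) : s ≠ 0 := by
  rintro rfl
  exact hφ.ne_zero_of_eq_true h rfl

theorem filterOf_injective : Function.Injective (filterOf (L := L)) := fun _ _ h =>
  funext fun e => Bool.eq_iff_iff.2 (Set.ext_iff.1 h e)

namespace Omega

theorem isCharacter (x : L.Omega) : IsCharacter x.char := x.char_mem.1

theorem exists_elt_eq_tri (x : L.Omega) : ∃ t, x.elt = .tri t := by
  rcases h : x.elt with _ | t
  · exact absurd h (x.isCharacter.elt_ne_zero x.mem_domain)
  · exact ⟨t, rfl⟩

theorem mem_domain_of_eq {x : L.Omega} {t : L.Triple} (h : x.elt = .tri t) :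
    x.char (dom (.tri t)) = true :=
  h ▸ x.mem_domain

end Omega

/-- For s = (α, A, β) and t = (αε, B, βε), the idempotent e = (βε, r(A,ε) ∩ B, βε) is the meet of
s*s and t*t, and se and te both equal (αε, r(A,ε) ∩ B, βε). -/
theorem mul_eq_mul_of_append {φ : L.Idem → Bool} (hφ : IsCharacter φ) {s t : L.Triple}
    (hs : φ (dom (.tri s)) = true) (ht : φ (dom (.tri t)) = true) {ε : List 𝒜}
    (hl : t.left = s.left ++ ε) (hr : t.right = s.right ++ ε) :
    ∃ e : L.Idem, φ e = true ∧ S.tri s * e.1 = S.tri t * e.1 := by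
  have ht' := set_mem_fiber_iff.2 ht
  rw [hr] at ht'
  have h := hφ.inter_mem_fiber (set_mem_fiber_iff.2 hs) ht'
  rw [← hr] at h
  obtain ⟨e, he, e', he', h1, h2, h3⟩ := h
  have hne := e'.nonempty
  rw [h2] at hne
  refine ⟨e, he, ?_⟩
  rw [he']
  have h4 : S.tri t * S.tri e' = S.tri ⟨t.left, L.relRange s.set ε ∩ t.set, t.right,
      t.left_labelled, t.right_labelled,
      by rw [Set.inter_comm]
         exact inter_mem_famAt t.mem_left (relRange_mem_fam s.mem_left.1
          (hne.mono Set.inter_subset_left)),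
      by rw [Set.inter_comm]
         exact inter_mem_famAt t.mem_right (relRange_mem_fam s.mem_left.1
          (hne.mono Set.inter_subset_left)), hne⟩ := by
    refine Triple.mul_eq_tri h1 rfl ?_ h3.symm
    rw [h2]
    exact (Set.inter_eq_right.2 Set.inter_subset_right).symm
  rw [h4]
  rcases Triple.mul_of_left_eq (s := s) (t := e') (ε := ε) (h1.trans hr) with
    ⟨-, h'⟩ | ⟨u, hu, u1, u2, u3⟩
  · rw [h2, Set.inter_eq_right.2 Set.inter_subset_left] at h'
    exact absurd h' hne.ne_empty
  · rw [hu]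
    refine congrArg S.tri (Triple.ext' (u1.trans hl.symm) (u2.trans ?_) (u3.trans h3))
    rw [h2]
    exact Set.inter_eq_right.2 Set.inter_subset_left

theorem isLabelledWord_of_append {w : LWord 𝒜} {β : List 𝒜} {ξ : Set L.Idem}
    (h : L.HasWord ξ (w.append β)) : L.IsLabelledWord w := by
  refine isLabelledWord_of_hasPrefix fun δ hδ hp => ?_
  have := h.fiber_nonempty (δ := β ++ δ) (by simp [hδ]) (LWord.hasPrefix_append_iff.2 hp)
  obtain ⟨A, hA⟩ := this
  exact isLabelled_of_famAt (famAt_append_subset _ _ (fiber_subset_famAt hA))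
    (nonempty_of_mem_fiber hA)

section

variable (hw : L.WeaklyLeftResolving)
include hw

theorem IsCharacter.exists_hasWord_append {φ : L.Idem → Bool} (hφ : IsCharacter φ)
    {t : L.Triple} (ht : φ (dom (.tri t)) = true) :
    ∃ w : LWord 𝒜, L.HasWord (filterOf φ) (w.append t.right) := by
  obtain ⟨w, h⟩ := hφ.exists_hasWord hw
  obtain ⟨w', rfl⟩ := (h.hasPrefix ⟨_, set_mem_fiber_iff.2 ht⟩).exists_append
  exact ⟨w', h⟩

/-- The element `(θ_s(φ), |α| - |β|, φ)` of `Γ` for `s = (α, A, β)`. -/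
noncomputable def Omega.toBoundary (x : L.Omega) : L.Boundary :=
  ⟨(⟨filterOf (act x.elt x.char), _, act_mem_tightSpectrum hw x.char_mem x.mem_domain, rfl⟩,
    x.elt.degree, ⟨filterOf x.char, _, x.char_mem, rfl⟩), by
    obtain ⟨t, ht⟩ := x.exists_elt_eq_tri
    have hd := Omega.mem_domain_of_eq ht
    obtain ⟨w, hword⟩ := x.isCharacter.exists_hasWord_append hw hd
    refine ⟨t.left, t.right, w, t.left_labelled, t.right_labelled,
      isLabelledWord_of_append hword, ?_, hword, ?_, ?_⟩
    · simp only [ht]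
      exact x.isCharacter.hasWord_act hw hd hword
    · simp only [ht]
      rfl
    · simp only [ht]
      exact x.isCharacter.cut_act hw hd hword⟩

/-- With `t.right = s.right ++ ε`, the word of the common image begins with both `t.left` and
`s.left ++ ε`; equal degrees give these equal lengths, hence they coincide. -/
theorem mul_eq_mul_of_prefix {φ : L.Idem → Bool} (hφ : IsCharacter φ) {s t : L.Triple}
    (hs : φ (dom (.tri s)) = true) (ht : φ (dom (.tri t)) = true) (hp : s.right <+: t.right)
    (hdeg : (S.tri s).degree = (S.tri t).degree) (hact : act (.tri s) φ = act (.tri t) φ) :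
    ∃ e : L.Idem, φ e = true ∧ S.tri s * e.1 = S.tri t * e.1 := by
  obtain ⟨ε, hε⟩ := hp
  refine mul_eq_mul_of_append hφ hs ht ?_ hε.symm
  have hη := hφ.act hw hs
  obtain ⟨w, h⟩ := hφ.exists_hasWord_append hw ht
  have h1 := hφ.hasWord_act hw ht h
  rw [← hε, LWord.append_append] at h
  have h2 := hφ.hasWord_act hw hs h
  rw [← hact] at h1
  have h3 := h1.unique h2
  rw [← LWord.append_append] at h3
  have h4 := w.hasPrefix_append_self t.left
  have h5 := w.hasPrefix_append_self (s.left ++ ε)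
  rw [← h3] at h5
  have hlen : t.left.length = (s.left ++ ε).length := by
    simp only [S.degree, ← hε, List.length_append] at hdeg ⊢
    push_cast at hdeg
    omega
  exact h4.2.symm.trans (hlen ▸ h5.2)

theorem toBoundary_eq_iff (x y : L.Omega) :
    x.toBoundary hw = y.toBoundary hw ↔ L.germRel x y := by
  constructor
  · intro h
    have h' := congrArg Subtype.val h
    have h1 : act x.elt x.char = act y.elt y.char :=
      filterOf_injective (congrArg (fun z : L.tightFilters × ℤ × L.tightFilters => z.1.1) h')
    have h2 : x.elt.degree = y.elt.degree :=
      congrArg (fun z : L.tightFilters × ℤ × L.tightFilters => z.2.1) h'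
    have h3 : x.char = y.char :=
      filterOf_injective (congrArg (fun z : L.tightFilters × ℤ × L.tightFilters => z.2.2.1) h')
    refine ⟨h3, ?_⟩
    obtain ⟨s, hs⟩ := x.exists_elt_eq_tri
    obtain ⟨t, ht⟩ := y.exists_elt_eq_tri
    have hds := Omega.mem_domain_of_eq hs
    have hdt := Omega.mem_domain_of_eq ht
    rw [← h3, hs, ht] at h1
    rw [hs, ht] at h2 ⊢
    rw [← h3] at hdt
    -- Both right words have non-empty fibres in the same filter, so one is a beginning of the
    -- other.
    rcases x.isCharacter.fiber_comparable ⟨_, set_mem_fiber_iff.2 hds⟩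
      ⟨_, set_mem_fiber_iff.2 hdt⟩ with hp | hp
    · exact mul_eq_mul_of_prefix hw x.isCharacter hds hdt hp h2 h1
    · obtain ⟨e, he, h⟩ := mul_eq_mul_of_prefix hw x.isCharacter hdt hds hp h2.symm h1.symm
      exact ⟨e, he, h.symm⟩
  · rintro ⟨h, e, he, hxy⟩
    have h1 : act x.elt x.char = act y.elt y.char := by
      rw [← h, x.isCharacter.act_congr hw he hxy]
    -- Since θ_e(φ) = φ, the idempotent (se)*(se) lies in the filter, so se ≠ 0 and degrees may be
    -- compared through se = te.
    have hne : x.elt * e.1 ≠ 0 := by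
      refine x.isCharacter.elt_ne_zero ((act_dom hw _ _ _).symm.trans ?_)
      rw [x.isCharacter.act_idem he]
      exact x.mem_domain
    have h2 : x.elt.degree = y.elt.degree := by
      have h3 := S.degree_mul hne
      have h4 := S.degree_mul (hxy ▸ hne)
      rw [e.2.degree_eq, add_zero] at h3 h4
      rw [← h3, ← h4, hxy]
    exact Subtype.ext (Prod.ext (Subtype.ext (congrArg filterOf h1))
      (Prod.ext h2 (Subtype.ext (congrArg filterOf h))))

theorem toBoundary_surjective : Function.Surjective (Omega.toBoundary (L := L) hw) := by
  rintro ⟨⟨⟨_, φ, hφ, rfl⟩, m, ⟨_, ψ, hψ, rfl⟩⟩, α, β, w, -, -, -, h, h', hm, hc⟩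
  obtain ⟨t, ht, hd, hact⟩ := exists_act_eq hw hφ.1 hψ.1 h h' hc
  refine ⟨⟨.tri t, ψ, hψ, hd⟩, Subtype.ext ?_⟩
  exact Prod.ext (Subtype.ext hact) (Prod.ext (ht.trans hm.symm) rfl)

theorem equivalence_germRel : Equivalence L.germRel where
  refl x := (toBoundary_eq_iff hw x x).1 rfl
  symm h := (toBoundary_eq_iff hw _ _).1 ((toBoundary_eq_iff hw _ _).2 h).symm
  trans h h' := (toBoundary_eq_iff hw _ _).1
    (((toBoundary_eq_iff hw _ _).2 h).trans ((toBoundary_eq_iff hw _ _).2 h'))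

/-- The bijection from the germs to `Γ`. -/
noncomputable def germEquiv : L.Germ ≃ L.Boundary :=
  Equiv.ofBijective
    (Quot.lift (Omega.toBoundary hw) fun x y h => (toBoundary_eq_iff hw x y).2 h) <| by
    constructor
    · rintro ⟨x⟩ ⟨y⟩ h
      exact Quot.sound ((toBoundary_eq_iff hw x y).1 h)
    · intro z
      obtain ⟨x, hx⟩ := toBoundary_surjective hw z
      exact ⟨Quot.mk _ x, hx⟩

/-- The product of composable pairs in `Ω`. -/
noncomputable def Omega.mul (x y : L.Omega) (h : x.char = act y.elt y.char) : L.Omega where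
  elt := x.elt * y.elt
  char := y.char
  char_mem := y.char_mem
  mem_domain := by
    have := x.mem_domain
    rw [h] at this
    exact (act_dom hw x.elt y.elt y.char).symm.trans this

/-- The inverse of a pair in `Ω`. -/
noncomputable def Omega.inv (x : L.Omega) : L.Omega where
  elt := star x.elt
  char := act x.elt x.char
  char_mem := act_mem_tightSpectrum hw x.char_mem x.mem_domain
  mem_domain := (act_dom_star hw x.elt x.char).trans x.mem_domain

theorem Omega.toBoundary_mul (x y : L.Omega) (h : x.char = act y.elt y.char) :
    ((x.mul hw y h).toBoundary hw).1 = ((x.toBoundary hw).1.1,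
      (x.toBoundary hw).1.2.1 + (y.toBoundary hw).1.2.1, (y.toBoundary hw).1.2.2) := by
  refine Prod.ext (Subtype.ext ?_) (Prod.ext (S.degree_mul ?_) rfl)
  · simp only [Omega.toBoundary, Omega.mul, act_mul hw, h]
  · exact y.isCharacter.elt_ne_zero (x.mul hw y h).mem_domain

theorem Omega.toBoundary_inv (x : L.Omega) :
    ((x.inv hw).toBoundary hw).1 = ((x.toBoundary hw).1.2.2, -(x.toBoundary hw).1.2.1,
      (x.toBoundary hw).1.1) := by
  refine Prod.ext (Subtype.ext ?_) (Prod.ext (S.degree_star _) rfl)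
  exact congrArg filterOf (x.isCharacter.act_star_act hw x.mem_domain)

theorem toBoundary_comp_iff (x y : L.Omega) :
    (x.toBoundary hw).1.2.2 = (y.toBoundary hw).1.1 ↔ x.char = act y.elt y.char :=
  Subtype.ext_iff.trans filterOf_injective.eq_iff

/-- Γ is closed under products because its elements lift to Ω, where composable pairs can be
multiplied; decompositions of words need not be compared. -/
theorem exists_boundary_mul (x y : L.Boundary) (h : x.1.2.2 = y.1.1) :
    ∃ z : L.Boundary, z.1 = (x.1.1, x.1.2.1 + y.1.2.1, y.1.2.2) := by
  obtain ⟨x, rfl⟩ := toBoundary_surjective hw x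
  obtain ⟨y, rfl⟩ := toBoundary_surjective hw y
  exact ⟨_, x.toBoundary_mul hw y ((toBoundary_comp_iff hw x y).1 h)⟩

theorem exists_boundary_inv (x : L.Boundary) :
    ∃ z : L.Boundary, z.1 = (x.1.2.2, -x.1.2.1, x.1.1) := by
  obtain ⟨x, rfl⟩ := toBoundary_surjective hw x
  exact ⟨_, x.toBoundary_inv hw⟩

/-- The boundary path groupoid. -/
noncomputable def boundaryGroupoid : AlgGroupoid L.Boundary where
  Comp x y := x.1.2.2 = y.1.1
  mul x y h := ⟨(x.1.1, x.1.2.1 + y.1.2.1, y.1.2.2), by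
    obtain ⟨z, hz⟩ := exists_boundary_mul hw x y h
    exact hz ▸ z.2⟩
  inv x := ⟨(x.1.2.2, -x.1.2.1, x.1.1), by
    obtain ⟨z, hz⟩ := exists_boundary_inv hw x
    exact hz ▸ z.2⟩
  inv_inv x := Subtype.ext (by simp)
  assoc x y z h h' := ⟨h', h, Subtype.ext (by simp [add_assoc])⟩
  inv_comp x := rfl
  comp_inv x := rfl
  inv_mul x y h := ⟨rfl, Subtype.ext (by simp [h])⟩
  mul_inv x y h := ⟨rfl, Subtype.ext (by simp [← h])⟩

theorem isBoundaryGroupoid_boundaryGroupoid :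
    IsBoundaryGroupoid (boundaryGroupoid (L := L) hw) where
  comp_iff _ _ := Iff.rfl
  mul_eq _ _ _ := rfl
  inv_eq _ := rfl

/-- The tight groupoid. -/
noncomputable def tightGroupoid : AlgGroupoid L.Germ :=
  AlgGroupoid.transport (germEquiv hw) (boundaryGroupoid hw)

/-- The transported operations are those of germs because `Omega.toBoundary` carries st and s* to
the product and the inverse of Γ. -/
theorem isTightGroupoid_tightGroupoid : IsTightGroupoid (tightGroupoid (L := L) hw) where
  comp_iff x y := toBoundary_comp_iff hw x y
  mul_eq x y h := ⟨x.mul hw y ((toBoundary_comp_iff hw x y).1 h), rfl, rfl,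
    (Equiv.symm_apply_eq _).2 (Subtype.ext (x.toBoundary_mul hw y _).symm)⟩
  inv_eq x := ⟨x.inv hw, rfl, rfl,
    (Equiv.symm_apply_eq _).2 (Subtype.ext (x.toBoundary_inv hw).symm)⟩

end

end LabelledSpace

theorem mainTheorem2 {V D 𝒜 : Type*} (L : LabelledSpace V D 𝒜)
    (hwlr : L.WeaklyLeftResolving) (hnormal : L.Normal) :
    Equivalence L.germRel ∧
    ∃ (𝒢 : AlgGroupoid L.Germ) (ℬ : AlgGroupoid L.Boundary),
      LabelledSpace.IsTightGroupoid 𝒢 ∧ LabelledSpace.IsBoundaryGroupoid ℬ ∧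
      ∃ Φ : 𝒢.Iso ℬ, ∀ (x : L.Omega) (t : L.Triple), x.elt = .tri t →
        (∃! α' : LWord 𝒜,
          L.HasWord (LabelledSpace.filterOf x.char) (α'.append t.right)) ∧
        ∀ α' : LWord 𝒜, L.HasWord (LabelledSpace.filterOf x.char) (α'.append t.right) →
          L.cut t.right α' (LabelledSpace.filterOf x.char) ∈ L.glueDomain t.right α' ∧
          L.cut t.right α' (LabelledSpace.filterOf x.char) ∈ L.glueDomain t.left α' ∧
          L.glue t.left α' (L.cut t.right α' (LabelledSpace.filterOf x.char)) ∈
            L.tightWithWord (α'.append t.left) ∧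
          ((Φ.toEquiv (LabelledSpace.germ x)).1.1 : Set L.Idem) =
            L.glue t.left α' (L.cut t.right α' (LabelledSpace.filterOf x.char)) ∧
          (Φ.toEquiv (LabelledSpace.germ x)).1.2.1 =
            (t.left.length : ℤ) - (t.right.length : ℤ) ∧
          ((Φ.toEquiv (LabelledSpace.germ x)).1.2.2 : Set L.Idem) =
            LabelledSpace.filterOf x.char := by
  refine ⟨LabelledSpace.equivalence_germRel hwlr, LabelledSpace.tightGroupoid hwlr,
    LabelledSpace.boundaryGroupoid hwlr, LabelledSpace.isTightGroupoid_tightGroupoid hwlr,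
    LabelledSpace.isBoundaryGroupoid_boundaryGroupoid hwlr, AlgGroupoid.transportIso _ _,
    fun x t ht => ⟨?_, fun w h => ?_⟩⟩
  · obtain ⟨w, h⟩ := x.isCharacter.exists_hasWord_append hwlr
      (LabelledSpace.Omega.mem_domain_of_eq ht)
    exact ⟨w, h, fun w' h' => LWord.append_right_injective _ (h'.unique h)⟩
  · have hφ := x.isCharacter
    have hd := LabelledSpace.Omega.mem_domain_of_eq ht
    have hglue := hφ.glue_cut_eq_act hwlr hd h
    -- The cut filter lies in both domains since the set of `t` is contained in both r(γ) and r(β).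
    refine ⟨hφ.cut_mem_glueDomain hwlr x.char_mem hd h t.mem_right,
      hφ.cut_mem_glueDomain hwlr x.char_mem hd h t.mem_left, ?_, ?_, ?_, rfl⟩
    · rw [hglue]
      exact ⟨⟨_, LabelledSpace.act_mem_tightSpectrum hwlr x.char_mem hd, rfl⟩,
        hφ.hasWord_act hwlr hd h⟩
    · rw [hglue, ← ht]
      rfl
    · change x.elt.degree = _
      rw [ht]
      rfl
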